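/- Consider the nonstochastic $K$-armed bandit with $K\ge 2$ actions and feedback delay $d\ge 0$. Loss vectors $\ell_1,\ell_2,\dots\in[0,1]^K$ are fixed in advance and hidden from the player. In each round $t=1,2,\dots$ the player draws an action $I_t\in\{1,\dots,K\}$ from a distribution depending on its past actions and on the losses observed so far, and suffers the loss $\ell_t(I_t)$; at the end of round $t$ it observes $\ell_{t-d}(I_{t-d})$ if $t>d$, and nothing otherwise. The regret is $$R_T=\mathbb E\Bigl[\sum_{t=1}^T\ell_t(I_t)\Bigr]-\min_{1\le i\le K}\sum_{t=1}^T\ell_t(i),$$ and the minimax regret $R^*_T(K,d)$ is the infimum over all randomized strategies of the player of the supremum of $R_T$ over all loss sequences. Then $R^*_T(K,d)$ is of order $\sqrt{(K+d)T}$ up to logarithmic factors (and up to the trivial bound $T$). Precisely, there are universal constants $c,C>0$ such that for all integers $K\ge 2$, $d\ge 0$, $T\ge 0$, $$c\,\min\bigl\{T,\sqrt{(K+d)T}\bigr\}\;\le\;R^*_T(K,d)\;\le\;C\,\min\bigl\{T,\sqrt{(K+d)T\ln K}\bigr\};$$ in particular $c\sqrt{(K+d)T}\le R^*_T(K,d)\le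 C\sqrt{(K+d)T\ln K}$ whenever $T\ge K+d$. Moreover, for all such $K,d,T$ there is a learning rate $\eta>0$ (depending only on $K,d,T$) for which Exp3 with delay satisfies $R_T\le C\bigl(d+\sqrt{(K+d)T\ln K}\bigr)$ for every loss sequence. This is the strategy that draws $I_t$ from $p_t(i)=w_t(i)/\sum_j w_t(j)$, where $w_1(i)=1$ and $w_{t+1}(i)=p_t(i)\exp(-\eta\,\widehat\ell_t(i))$, with $\widehat\ell_t(i)=\frac{\ell_{t-d}(i)}{p_{t-d}(i)}\mathbf 1\{I_{t-d}=i\}$ if $t>d$ and $\widehat\ell_t(i)=0$ otherwise. -/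

import Mathlib

namespace DelayedBandit

/-- A randomized strategy for the `K`-armed bandit in which losses are revealed with delay `d`.
Rounds are numbered from `0`. Before round `t` is played the strategy knows its own actions in
rounds `0, …, t - 1` and the losses suffered in the rounds `s` with `s + d < t`, that is in rounds
`0, …, t - d - 1` (none if `t ≤ d`). From these it computes the distribution of the next action. -/
abbrev Strategy (K d : ℕ) : Type :=
  (t : ℕ) → (Fin t → Fin K) → (Fin (t - d) → ℝ) → stdSimplex ℝ (Fin K)

/-- Loss sequences: `ℓ t i ∈ [0, 1]` is the loss of action `i` in round `t`. -/
abbrev LossSeq (K : ℕ) : Type := ℕ → Fin K → Set.Icc (0 : ℝ) 1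

variable {K d : ℕ}

/-- The conditional probability with which the strategy plays `a t` in round `t`, given that its
earlier actions were `a 0, …, a (t - 1)`. -/
noncomputable def stepProb (π : Strategy K d) (ℓ : LossSeq K) {T : ℕ} (a : Fin T → Fin K)
    (t : Fin T) : ℝ :=
  (π t (fun s => a ⟨s, s.isLt.trans t.isLt⟩)
    (fun s => ℓ s (a ⟨s, (s.isLt.trans_le (Nat.sub_le _ _)).trans t.isLt⟩)) : Fin K → ℝ) (a t)

/-- The probability that the actions of the first `T` rounds are `a`, when the losses are `ℓ`. -/
noncomputable def actionProb (π : Strategy K d) (ℓ : LossSeq K) {T : ℕ} (a : Fin T → Fin K) : ℝ :=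
  ∏ t, stepProb π ℓ a t

/-- The expected cumulative loss `𝔼 [∑ ℓ_t(I_t)]` over the first `T` rounds. -/
noncomputable def expectedLoss (π : Strategy K d) (ℓ : LossSeq K) (T : ℕ) : ℝ :=
  ∑ a : Fin T → Fin K, actionProb π ℓ a * ∑ t : Fin T, (ℓ t (a t) : ℝ)

/-- The regret over `T` rounds against the best fixed action. -/
noncomputable def regret (π : Strategy K d) (ℓ : LossSeq K) (T : ℕ) : ℝ :=
  expectedLoss π ℓ T - ⨅ i : Fin K, ∑ t ∈ Finset.range T, (ℓ t i : ℝ)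

/-- The minimax regret over `T` rounds with `K` actions and delay `d`. -/
noncomputable def minimaxRegret (K d T : ℕ) : ℝ :=
  ⨅ π : Strategy K d, ⨆ ℓ : LossSeq K, regret π ℓ T

/-- The weights of Exp3 with learning rate `η` and delay `d`: `w₀ = 1` and
`w_{t+1}(i) = p_t(i) exp (-η ℓ̂_t(i))`, where `p_t = w_t / ∑ j, w_t(j)`, and where the loss
estimate `ℓ̂_t(i)` is `y (t - d) i / p_{t-d}(i)` if `t ≥ d` and `0` otherwise. Here `y s i` stands
for the loss of round `s` if action `i` was played in round `s`, and for `0` otherwise. -/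
noncomputable def exp3Weight (d : ℕ) (η : ℝ) (y : ℕ → Fin K → ℝ) : ℕ → Fin K → ℝ
  | 0 => fun _ => 1
  | t + 1 => fun i =>
      exp3Weight d η y t i / (∑ j, exp3Weight d η y t j) *
        Real.exp (-η * (if d ≤ t then
          y (t - d) i / (exp3Weight d η y (t - d) i / ∑ j, exp3Weight d η y (t - d) j) else 0))
  termination_by t => t
  decreasing_by all_goals omega

theorem exp3Weight_pos (d : ℕ) (η : ℝ) (y : ℕ → Fin K → ℝ) (t : ℕ) (i : Fin K) :
    0 < exp3Weight d η y t i := by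
  induction t generalizing i with
  | zero => simp [exp3Weight]
  | succ t ih =>
    rw [exp3Weight]
    exact mul_pos (div_pos (ih i) (Finset.sum_pos (fun j _ => ih j) ⟨i, Finset.mem_univ i⟩))
      (Real.exp_pos _)

/-- Exp3 with learning rate `η`, each loss being used as soon as it is revealed. -/
noncomputable def exp3 (hK : 0 < K) (d : ℕ) (η : ℝ) : Strategy K d := fun t a x =>
  let y : ℕ → Fin K → ℝ := fun s i =>
    if h : s < t - d then
      (if a ⟨s, h.trans_le (Nat.sub_le _ _)⟩ = i then x ⟨s, h⟩ else 0)
    else 0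
  ⟨fun i => exp3Weight d η y t i / ∑ j, exp3Weight d η y t j, by
    have hpos : 0 < ∑ j, exp3Weight d η y t j :=
      Finset.sum_pos (fun j _ => exp3Weight_pos d η y t j) ⟨⟨0, hK⟩, Finset.mem_univ _⟩
    refine ⟨fun i => (div_pos (exp3Weight_pos d η y t i) hpos).le, ?_⟩
    rw [← Finset.sum_div, div_self hpos.ne']⟩

end DelayedBandit

/-!
*Upper bound.* In one round Exp3 multiplies each probability by at most `1 / (1 - 2η)`, by induction
along the delay. Loss estimates that arrive `d` rounds late therefore remain controlled under the
current distribution, and the usual logarithmic potential gives the regret bound.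

*Lower bound.* If the losses are coin flips with one slightly biased arm, an arm that is pulled
rarely cannot be detected, by the chain rule for relative entropy and Pinsker's inequality: this
costs `√(K T)`. If the losses are instead constant on blocks of length at most `d + 1`, with
independent random signs, the player learns the sign of a block only after the block has ended,
whereas the better of two fixed actions gains the absolute value of a random sign sum, which by
Khintchine's inequality is of order `√(d T)`.
-/

namespace DelayedBandit

section FiniteLaw

variable {ι κ : Type*} [Fintype ι] [Fintype κ]

/-- The expectation of `f` under the probability vector `P`. -/
noncomputable def expectation (P : stdSimplex ℝ ι) (f : ι → ℝ) : ℝ :=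
  ∑ i, P i * f i

theorem expectation_add (P : stdSimplex ℝ ι) (f g : ι → ℝ) :
    expectation P (fun i => f i + g i) = expectation P f + expectation P g := by
  simp only [expectation, mul_add, Finset.sum_add_distrib]

theorem expectation_sub (P : stdSimplex ℝ ι) (f g : ι → ℝ) :
    expectation P (fun i => f i - g i) = expectation P f - expectation P g := by
  simp only [expectation, mul_sub, Finset.sum_sub_distrib]

theorem expectation_const_mul (P : stdSimplex ℝ ι) (c : ℝ) (f : ι → ℝ) :
    expectation P (fun i => c * f i) = c * expectation P f := by
  simp only [expectation, Finset.mul_sum, mul_left_comm]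

theorem expectation_sum (P : stdSimplex ℝ ι) {J : Type*} (s : Finset J) (f : J → ι → ℝ) :
    expectation P (fun i => ∑ j ∈ s, f j i) = ∑ j ∈ s, expectation P (f j) := by
  simp only [expectation, Finset.mul_sum]
  exact Finset.sum_comm

@[simp]
theorem expectation_const (P : stdSimplex ℝ ι) (c : ℝ) : expectation P (fun _ => c) = c := by
  rw [expectation, ← Finset.sum_mul, stdSimplex.sum_eq_one, one_mul]

theorem expectation_mono (P : stdSimplex ℝ ι) {f g : ι → ℝ} (h : ∀ i, f i ≤ g i) :
    expectation P f ≤ expectation P g :=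
  Finset.sum_le_sum fun i _ => mul_le_mul_of_nonneg_left (h i) (stdSimplex.zero_le P i)

theorem expectation_nonneg (P : stdSimplex ℝ ι) {f : ι → ℝ} (h : ∀ i, 0 ≤ f i) :
    0 ≤ expectation P f :=
  Finset.sum_nonneg fun i _ => mul_nonneg (stdSimplex.zero_le P i) (h i)

theorem expectation_comm (P : stdSimplex ℝ ι) (Q : stdSimplex ℝ κ) (f : ι → κ → ℝ) :
    expectation P (fun i => expectation Q (f i)) =
      expectation Q fun j => expectation P fun i => f i j := by
  simp only [expectation, Finset.mul_sum, mul_left_comm (P _)]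
  exact Finset.sum_comm

theorem expectation_barycenter_mul_right {G : Type*} [Group G] [Fintype G] (f : G → ℝ) (g : G) :
    expectation stdSimplex.barycenter (fun x => f (x * g)) =
      expectation stdSimplex.barycenter f :=
  Equiv.sum_comp (Equiv.mulRight g) fun x => (Fintype.card G : ℝ)⁻¹ * f x

theorem sq_expectation_le_mul (P : stdSimplex ℝ ι) {f g h : ι → ℝ} (hf : ∀ i, 0 ≤ f i)
    (hg : ∀ i, 0 ≤ g i) (hh : ∀ i, h i ^ 2 ≤ f i * g i) :
    expectation P h ^ 2 ≤ expectation P f * expectation P g :=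
  Finset.sum_sq_le_sum_mul_sum_of_sq_le_mul _
    (fun i _ => mul_nonneg (stdSimplex.zero_le P i) (hf i))
    (fun i _ => mul_nonneg (stdSimplex.zero_le P i) (hg i)) fun i _ => by
      nlinarith [mul_le_mul_of_nonneg_left (hh i) (sq_nonneg (P i))]

theorem cube_expectation_sq_le (P : stdSimplex ℝ ι) (X : ι → ℝ) :
    expectation P (fun i => X i ^ 2) ^ 3 ≤
      expectation P (fun i => |X i|) ^ 2 * expectation P fun i => X i ^ 4 := by
  set m₁ := expectation P fun i => |X i|
  set m₂ := expectation P fun i => X i ^ 2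
  set m₃ := expectation P fun i => |X i| ^ 3
  set m₄ := expectation P fun i => X i ^ 4
  have hm₂ : 0 ≤ m₂ := expectation_nonneg P fun i => sq_nonneg _
  have hm₄ : 0 ≤ m₄ := expectation_nonneg P fun i => (even_two.mul_left 2).pow_nonneg _
  have hsecond : m₂ ^ 2 ≤ m₁ * m₃ :=
    sq_expectation_le_mul P (fun i => abs_nonneg _) (fun i => pow_nonneg (abs_nonneg _) 3)
      fun i => by rw [← sq_abs (X i)]; apply le_of_eq; ring
  have hthird : m₃ ^ 2 ≤ m₂ * m₄ :=
    sq_expectation_le_mul P (fun i => sq_nonneg _) (fun i => (even_two.mul_left 2).pow_nonneg _)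
      fun i => by rw [← pow_mul, mul_comm 3, pow_mul, sq_abs]; apply le_of_eq; ring
  rcases hm₂.eq_or_lt with hzero | hpos
  · rw [← hzero, zero_pow three_ne_zero]
    exact mul_nonneg (sq_nonneg _) hm₄
  · refine le_of_mul_le_mul_left ?_ hpos
    calc m₂ * m₂ ^ 3 = (m₂ ^ 2) ^ 2 := by ring
      _ ≤ (m₁ * m₃) ^ 2 := pow_le_pow_left₀ (sq_nonneg _) hsecond 2
      _ = m₁ ^ 2 * m₃ ^ 2 := mul_pow _ _ _
      _ ≤ m₁ ^ 2 * (m₂ * m₄) := mul_le_mul_of_nonneg_left hthird (sq_nonneg _)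
      _ = m₂ * (m₁ ^ 2 * m₄) := by ring

/-- The joint law of a pair whose first entry has law `P` and whose second entry has the
conditional law `μ i` given that the first one is `i`. -/
noncomputable def compProd (P : stdSimplex ℝ ι) (μ : ι → stdSimplex ℝ κ) : stdSimplex ℝ (ι × κ) :=
  ⟨fun z => P z.1 * μ z.1 z.2,
    fun z => mul_nonneg (stdSimplex.zero_le P z.1) (stdSimplex.zero_le (μ z.1) z.2), by
    simp only [Fintype.sum_prod_type, ← Finset.mul_sum, stdSimplex.sum_eq_one, mul_one]⟩

theorem compProd_apply (P : stdSimplex ℝ ι) (μ : ι → stdSimplex ℝ κ) (z : ι × κ) :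
    compProd P μ z = P z.1 * μ z.1 z.2 :=
  rfl

theorem expectation_compProd (P : stdSimplex ℝ ι) (μ : ι → stdSimplex ℝ κ) (f : ι × κ → ℝ) :
    expectation (compProd P μ) f = expectation P fun i => expectation (μ i) fun x => f (i, x) := by
  simp only [expectation, compProd_apply, Fintype.sum_prod_type, Finset.mul_sum, mul_assoc]

/-- The law of independent coordinates, coordinate `i` having the law `μ i`. -/
noncomputable def piLaw [DecidableEq ι] (μ : ι → stdSimplex ℝ κ) : stdSimplex ℝ (ι → κ) :=
  ⟨fun ω => ∏ i, μ i (ω i), fun ω => Finset.prod_nonneg fun i _ => stdSimplex.zero_le (μ i) (ω i),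
    by rw [← Fintype.prod_sum]; simp only [stdSimplex.sum_eq_one, Finset.prod_const_one]⟩

theorem piLaw_apply [DecidableEq ι] (μ : ι → stdSimplex ℝ κ) (ω : ι → κ) :
    piLaw μ ω = ∏ i, μ i (ω i) :=
  rfl

theorem expectation_piLaw_apply [DecidableEq ι] (μ : ι → stdSimplex ℝ κ) (i : ι) (f : κ → ℝ) :
    expectation (piLaw μ) (fun ω => f (ω i)) = expectation (μ i) f := by
  calc expectation (piLaw μ) (fun ω => f (ω i))
      = ∑ ω : ι → κ, ∏ j, μ j (ω j) * (if j = i then f (ω j) else 1) := by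
        simp only [expectation, piLaw_apply, Finset.prod_mul_distrib, Finset.prod_ite_eq',
          Finset.mem_univ, if_true]
    _ = ∏ j, ∑ x, μ j x * (if j = i then f x else 1) := by rw [Fintype.prod_sum]
    _ = expectation (μ i) f := by
        rw [Finset.prod_eq_single i (fun j _ hj => by simp [hj]) (by simp)]
        simp [expectation]

end FiniteLaw

section SequentialLaw

variable {α : Type*}

/-- The entries of `a` before the one of index `t`. -/
def past {T : ℕ} (a : Fin T → α) (t : Fin T) : Fin t → α :=
  fun s => a ⟨s, s.isLt.trans t.isLt⟩

@[simp]
theorem past_snoc_last {n : ℕ} (a : Fin n → α) (x : α) :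
    past (Fin.snoc a x : Fin (n + 1) → α) (Fin.last n) = a := by
  funext s
  exact Fin.snoc_castSucc (α := fun _ => α) x a s

@[simp]
theorem past_snoc_castSucc {n : ℕ} (a : Fin n → α) (x : α) (t : Fin n) :
    past (Fin.snoc a x : Fin (n + 1) → α) t.castSucc = past a t := by
  funext s
  exact Fin.snoc_castSucc (α := fun _ => α) x a ⟨s, s.isLt.trans t.isLt⟩

theorem sum_univ_snoc [Fintype α] {n : ℕ} (f : (Fin (n + 1) → α) → ℝ) :
    ∑ a, f a = ∑ a : Fin n → α, ∑ x, f (Fin.snoc a x) := by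
  rw [← (Fin.snocEquiv fun _ => α).sum_comp, Fintype.sum_prod_type_right]
  rfl

variable [Fintype α]

/-- A transition rule on `α` with memory: `q n h` is the law of the entry of index `n` of a random
sequence whose earlier entries are `h`. -/
abbrev SeqKernel (α : Type*) [Fintype α] : Type _ :=
  (n : ℕ) → (Fin n → α) → stdSimplex ℝ α

/-- The probability that a sequence generated by `q` starts with `a`. -/
noncomputable def pathProb (q : SeqKernel α) {T : ℕ} (a : Fin T → α) : ℝ :=
  ∏ t : Fin T, q t (past a t) (a t)

theorem pathProb_snoc (q : SeqKernel α) {n : ℕ} (a : Fin n → α) (x : α) :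
    pathProb q (Fin.snoc a x : Fin (n + 1) → α) = pathProb q a * q n a x := by
  unfold pathProb
  rw [Fin.prod_univ_castSucc]
  congr 1
  · refine Finset.prod_congr rfl fun t _ => ?_
    rw [past_snoc_castSucc, Fin.snoc_castSucc]
    rfl
  · rw [past_snoc_last, Fin.snoc_last]
    rfl

theorem sum_pathProb (q : SeqKernel α) (T : ℕ) : ∑ a : Fin T → α, pathProb q a = 1 := by
  induction T with
  | zero => simp [pathProb]
  | succ n ih =>
    simpa only [sum_univ_snoc, pathProb_snoc, ← Finset.mul_sum, stdSimplex.sum_eq_one, mul_one]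
      using ih

/-- The law of the first `T` entries of a sequence generated by `q`. -/
noncomputable def seqLaw (q : SeqKernel α) (T : ℕ) : stdSimplex ℝ (Fin T → α) :=
  ⟨pathProb q, fun _ => Finset.prod_nonneg fun _ _ => stdSimplex.zero_le _ _, sum_pathProb q T⟩

theorem seqLaw_apply (q : SeqKernel α) {T : ℕ} (a : Fin T → α) : seqLaw q T a = pathProb q a :=
  rfl

theorem seqLaw_congr {T : ℕ} {p q : SeqKernel α} (h : ∀ n < T, p n = q n) :
    seqLaw p T = seqLaw q T :=
  stdSimplex.ext <| funext fun a => by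
    simp only [seqLaw_apply, pathProb, h _ (Fin.isLt _)]

theorem seqLaw_eq_zero {T : ℕ} {p q : SeqKernel α}
    (h : ∀ n a x, q n a x = 0 → p n a x = 0) {a : Fin T → α} (ha : seqLaw q T a = 0) :
    seqLaw p T a = 0 := by
  rw [seqLaw_apply, pathProb] at ha ⊢
  obtain ⟨t, ht, hzero⟩ := Finset.prod_eq_zero_iff.1 ha
  exact Finset.prod_eq_zero ht (h _ _ _ hzero)

theorem expectation_seqLaw_succ (q : SeqKernel α) (n : ℕ) (f : (Fin (n + 1) → α) → ℝ) :
    expectation (seqLaw q (n + 1)) f =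
      expectation (seqLaw q n) fun a => expectation (q n a) fun x => f (Fin.snoc a x) := by
  simp only [expectation, seqLaw_apply, sum_univ_snoc, pathProb_snoc, Finset.mul_sum, mul_assoc]

theorem expectation_seqLaw_past_apply (q : SeqKernel α) {T : ℕ} (t : Fin T)
    (g : (Fin t → α) → α → ℝ) :
    expectation (seqLaw q T) (fun a => g (past a t) (a t)) =
      expectation (seqLaw q t) fun h => expectation (q t h) (g h) := by
  induction T with
  | zero => exact t.elim0
  | succ n ih =>
    rw [expectation_seqLaw_succ]
    induction t using Fin.lastCases with
    | last => simp only [past_snoc_last, Fin.snoc_last]; rfl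
    | cast t =>
      simp only [past_snoc_castSucc, Fin.snoc_castSucc, expectation_const]
      exact ih t g

theorem expectation_seqLaw_condExp (q : SeqKernel α) {T : ℕ} (t : Fin T)
    (g : (Fin t → α) → α → ℝ) :
    expectation (seqLaw q T) (fun a => g (past a t) (a t)) =
      expectation (seqLaw q T) fun a => expectation (q t (past a t)) (g (past a t)) := by
  rw [expectation_seqLaw_past_apply q t g,
    expectation_seqLaw_past_apply q t fun h _ => expectation (q t h) (g h)]
  simp only [expectation_const]

theorem expectation_seqLaw_apply (q : SeqKernel α) {T : ℕ} (t : Fin T) (f : α → ℝ) :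
    expectation (seqLaw q T) (fun a => f (a t)) =
      expectation (seqLaw q T) fun a => expectation (q t (past a t)) f :=
  expectation_seqLaw_condExp q t fun _ => f

end SequentialLaw

section RelEntropy

variable {ι κ α : Type*} [Fintype ι] [Fintype κ] [Fintype α]

/-- The relative entropy (Kullback–Leibler divergence) of `P` with respect to `Q`. It is the usual
one only if `Q i = 0` implies `P i = 0`: because of `x / 0 = 0` and `log 0 = 0`, the terms with
`Q i = 0` vanish instead of being infinite. -/
noncomputable def relEntropy (P Q : stdSimplex ℝ ι) : ℝ :=
  expectation P fun i => Real.log (P i / Q i)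

theorem relEntropy_self (P : stdSimplex ℝ ι) : relEntropy P P = 0 :=
  Finset.sum_eq_zero fun i _ => by rcases eq_or_ne (P i) 0 with h | h <;> simp [h]

theorem relEntropy_compProd (P : stdSimplex ℝ ι) (μ ν : ι → stdSimplex ℝ κ) :
    relEntropy (compProd P μ) (compProd P ν) =
      expectation P fun i => relEntropy (μ i) (ν i) := by
  rw [relEntropy, expectation_compProd]
  refine Finset.sum_congr rfl fun i _ => ?_
  rcases eq_or_ne (P i) 0 with h | h
  · simp only [h, zero_mul]
  · simp only [compProd_apply, relEntropy, mul_div_mul_left _ _ h]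

/-- Only the conditional laws of the entries contribute to the relative entropy of two paths: this
is the chain rule. -/
theorem relEntropy_seqLaw {p q : SeqKernel α} (h : ∀ n a x, q n a x = 0 → p n a x = 0) (T : ℕ) :
    relEntropy (seqLaw p T) (seqLaw q T) =
      expectation (seqLaw p T) fun a =>
        ∑ t : Fin T, relEntropy (p t (past a t)) (q t (past a t)) := by
  calc relEntropy (seqLaw p T) (seqLaw q T)
      = expectation (seqLaw p T) fun a =>
          ∑ t : Fin T, Real.log (p t (past a t) (a t) / q t (past a t) (a t)) := by
        refine Finset.sum_congr rfl fun a _ => ?_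
        rcases eq_or_ne (seqLaw p T a) 0 with hp | hp
        · simp only [hp, zero_mul]
        · rw [seqLaw_apply, pathProb, Finset.prod_ne_zero_iff] at hp
          beta_reduce
          rw [seqLaw_apply, seqLaw_apply, pathProb, pathProb, ← Finset.prod_div_distrib,
            Real.log_prod fun t ht => div_ne_zero (hp t ht) fun hq => hp t ht (h _ _ _ hq)]
    _ = _ := by
        simp only [expectation_sum]
        exact Finset.sum_congr rfl fun t _ => expectation_seqLaw_condExp p t fun a x =>
          Real.log (p t a x / q t a x)

theorem sq_sqrt_sub_sqrt_le {p q : ℝ} (hp : 0 ≤ p) (hq : 0 ≤ q) (h : q = 0 → p = 0) :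
    (√p - √q) ^ 2 + (p - q) ≤ p * Real.log (p / q) := by
  rcases hp.eq_or_lt with rfl | hp'
  · simp [Real.sq_sqrt hq]
  have hq' : 0 < q := hq.lt_of_ne' fun hq0 => hp'.ne' (h hq0)
  have hlog : Real.log (q / p) ≤ 2 * (√(q / p) - 1) := by
    have := Real.log_le_sub_one_of_pos (Real.sqrt_pos.2 (div_pos hq' hp'))
    rw [Real.log_sqrt (div_pos hq' hp').le] at this
    linarith
  have hsqrt : p * √(q / p) = √p * √q := by
    rw [Real.sqrt_div hq, mul_div_assoc', div_eq_iff (Real.sqrt_pos.2 hp').ne',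
      mul_right_comm, Real.mul_self_sqrt hp]
  rw [← inv_div, Real.log_inv]
  nlinarith [mul_le_mul_of_nonneg_left hlog hp, Real.sq_sqrt hp, Real.sq_sqrt hq]

theorem sum_sq_sqrt_sub_sqrt_le_relEntropy {P Q : stdSimplex ℝ ι} (h : ∀ i, Q i = 0 → P i = 0) :
    ∑ i, (√(P i) - √(Q i)) ^ 2 ≤ relEntropy P Q := by
  have := Finset.sum_le_sum fun i (_ : i ∈ Finset.univ) =>
    sq_sqrt_sub_sqrt_le (stdSimplex.zero_le P i) (stdSimplex.zero_le Q i) (h i)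
  rwa [Finset.sum_add_distrib, Finset.sum_sub_distrib, stdSimplex.sum_eq_one,
    stdSimplex.sum_eq_one, sub_self, add_zero] at this

/-- Pinsker's inequality with `4` in place of the optimal `2`, which would take a finer inequality
than the passage through the Hellinger distance. -/
theorem sq_sum_abs_sub_le_relEntropy {P Q : stdSimplex ℝ ι} (h : ∀ i, Q i = 0 → P i = 0) :
    (∑ i, |P i - Q i|) ^ 2 ≤ 4 * relEntropy P Q := by
  have hsum : ∑ i, (√(P i) + √(Q i)) ^ 2 ≤ 4 := by
    calc ∑ i, (√(P i) + √(Q i)) ^ 2 ≤ ∑ i, 2 * (P i + Q i) := Finset.sum_le_sum fun i _ => by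
          nlinarith [Real.sq_sqrt (stdSimplex.zero_le P i), Real.sq_sqrt (stdSimplex.zero_le Q i),
            sq_nonneg (√(P i) - √(Q i))]
      _ = 4 := by
          rw [← Finset.mul_sum, Finset.sum_add_distrib, stdSimplex.sum_eq_one,
            stdSimplex.sum_eq_one]
          norm_num
  have hfactor : ∀ i, |P i - Q i| = |√(P i) - √(Q i)| * (√(P i) + √(Q i)) := fun i => by
    rw [← abs_of_nonneg (add_nonneg (Real.sqrt_nonneg (P i)) (Real.sqrt_nonneg (Q i))), ← abs_mul,
      mul_comm, ← sq_sub_sq, Real.sq_sqrt (stdSimplex.zero_le P i),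
      Real.sq_sqrt (stdSimplex.zero_le Q i)]
  calc (∑ i, |P i - Q i|) ^ 2
      ≤ (∑ i, |√(P i) - √(Q i)| ^ 2) * ∑ i, (√(P i) + √(Q i)) ^ 2 := by
        simp only [hfactor]
        exact Finset.sum_mul_sq_le_sq_mul_sq _ _ _
    _ ≤ relEntropy P Q * 4 := by
        simp only [sq_abs]
        have hle := sum_sq_sqrt_sub_sqrt_le_relEntropy h
        exact mul_le_mul hle hsum (Finset.sum_nonneg fun i _ => sq_nonneg _)
          ((Finset.sum_nonneg fun i _ => sq_nonneg _).trans hle)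
    _ = 4 * relEntropy P Q := mul_comm _ _

/-- `f` may be centred at `B / 2`, as `P` and `Q` have the same mass; this saves a factor `2`. -/
theorem expectation_le_add_sqrt_relEntropy {P Q : stdSimplex ℝ ι} (h : ∀ i, Q i = 0 → P i = 0)
    {f : ι → ℝ} {B : ℝ} (hf : ∀ i, f i ∈ Set.Icc 0 B) :
    expectation Q f ≤ expectation P f + B * √(relEntropy P Q) := by
  have hcentre : ∀ i, |f i - B / 2| ≤ B / 2 := fun i =>
    abs_le.2 ⟨by linarith [(hf i).1], by linarith [(hf i).2]⟩
  have hB : 0 ≤ B := by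
    obtain ⟨i, -⟩ := Finset.nonempty_of_sum_ne_zero (s := Finset.univ) (f := fun i => P i)
      (by rw [stdSimplex.sum_eq_one]; exact one_ne_zero)
    exact (hf i).1.trans (hf i).2
  have htv : ∑ i, |P i - Q i| ≤ 2 * √(relEntropy P Q) := by
    rw [show (2 : ℝ) = √4 by rw [show (4 : ℝ) = 2 ^ 2 by norm_num, Real.sqrt_sq two_pos.le],
      ← Real.sqrt_mul zero_le_four]
    exact Real.le_sqrt_of_sq_le (sq_sum_abs_sub_le_relEntropy h)
  calc expectation Q f
      = expectation P f + ∑ i, (Q i - P i) * (f i - B / 2) := by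
        simp only [expectation, sub_mul, mul_sub, Finset.sum_sub_distrib, ← Finset.sum_mul,
          stdSimplex.sum_eq_one]
        ring
    _ ≤ expectation P f + ∑ i, |P i - Q i| * (B / 2) := by
        refine add_le_add_right (Finset.sum_le_sum fun i _ => ?_) _
        rw [abs_sub_comm]
        exact (le_abs_self _).trans ((abs_mul _ _).trans_le
          (mul_le_mul_of_nonneg_left (hcentre i) (abs_nonneg _)))
    _ ≤ expectation P f + B * √(relEntropy P Q) := by
        rw [← Finset.sum_mul]
        nlinarith

end RelEntropy

section Regret

variable {K d T : ℕ}

/-- The actions drawn by `π` against the losses `ℓ`, as a transition rule with memory. -/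
def actionKernel (π : Strategy K d) (ℓ : LossSeq K) : SeqKernel (Fin K) :=
  fun n h => π n h fun s => ℓ s (h ⟨s, s.isLt.trans_le (Nat.sub_le _ _)⟩)

theorem actionKernel_congr (π : Strategy K d) {ℓ ℓ' : LossSeq K} {n : ℕ}
    (h : ∀ s, s + d < n → ℓ s = ℓ' s) : actionKernel π ℓ n = actionKernel π ℓ' n := by
  funext a
  unfold actionKernel
  congr 1
  funext s
  rw [h s (Nat.add_lt_of_lt_sub s.isLt)]

theorem expectedLoss_eq_expectation (π : Strategy K d) (ℓ : LossSeq K) (T : ℕ) :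
    expectedLoss π ℓ T =
      expectation (seqLaw (actionKernel π ℓ) T) fun a => ∑ t : Fin T, (ℓ t (a t) : ℝ) :=
  rfl

theorem sum_loss_nonneg (ℓ : LossSeq K) (T : ℕ) (i : Fin K) :
    0 ≤ ∑ t ∈ Finset.range T, (ℓ t i : ℝ) :=
  Finset.sum_nonneg fun t _ => (ℓ t i).2.1

theorem iInf_sum_loss_le (ℓ : LossSeq K) (T : ℕ) (i : Fin K) :
    ⨅ i : Fin K, ∑ t ∈ Finset.range T, (ℓ t i : ℝ) ≤ ∑ t ∈ Finset.range T, (ℓ t i : ℝ) :=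
  ciInf_le ⟨0, Set.forall_mem_range.2 (sum_loss_nonneg ℓ T)⟩ i

theorem expectedLoss_le_length (π : Strategy K d) (ℓ : LossSeq K) (T : ℕ) :
    expectedLoss π ℓ T ≤ T := by
  rw [expectedLoss_eq_expectation, ← expectation_const (seqLaw (actionKernel π ℓ) T) (T : ℝ)]
  refine expectation_mono _ fun a => ?_
  simpa using Finset.sum_le_card_nsmul Finset.univ (fun t : Fin T => (ℓ t (a t) : ℝ)) 1
    fun t _ => (ℓ t (a t)).2.2

theorem regret_le_length (π : Strategy K d) (ℓ : LossSeq K) (T : ℕ) : regret π ℓ T ≤ T :=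
  (sub_le_self _ (Real.iInf_nonneg (sum_loss_nonneg ℓ T))).trans (expectedLoss_le_length π ℓ T)

theorem bddAbove_regret (π : Strategy K d) (T : ℕ) :
    BddAbove (Set.range fun ℓ : LossSeq K => regret π ℓ T) :=
  ⟨T, Set.forall_mem_range.2 fun ℓ => regret_le_length π ℓ T⟩

theorem iSup_regret_nonneg (π : Strategy K d) (T : ℕ) : 0 ≤ ⨆ ℓ : LossSeq K, regret π ℓ T := by
  have hzero : regret π (fun _ _ => 0) T = 0 := by simp [regret, expectedLoss]
  exact hzero.ge.trans (le_ciSup (bddAbove_regret π T) _)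

theorem minimaxRegret_nonneg (K d T : ℕ) : 0 ≤ minimaxRegret K d T :=
  Real.iInf_nonneg fun π => iSup_regret_nonneg π T

theorem minimaxRegret_le (π : Strategy K d) {x : ℝ} (h : ∀ ℓ : LossSeq K, regret π ℓ T ≤ x) :
    minimaxRegret K d T ≤ x :=
  have : Nonempty (LossSeq K) := ⟨fun _ _ => 0⟩
  (ciInf_le ⟨0, Set.forall_mem_range.2 fun π => iSup_regret_nonneg π T⟩ π).trans (ciSup_le h)

theorem minimaxRegret_le_length (hK : 0 < K) (d T : ℕ) : minimaxRegret K d T ≤ T :=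
  minimaxRegret_le (exp3 hK d 1) fun ℓ => regret_le_length _ ℓ T

theorem le_minimaxRegret (hK : 0 < K) {x : ℝ}
    (h : ∀ π : Strategy K d, x ≤ ⨆ ℓ : LossSeq K, regret π ℓ T) : x ≤ minimaxRegret K d T :=
  have : Nonempty (Strategy K d) := ⟨exp3 hK d 1⟩
  le_ciInf h

theorem expectation_regret_le_iSup {Ω : Type*} [Fintype Ω] (P : stdSimplex ℝ Ω)
    (π : Strategy K d) (ℓ : Ω → LossSeq K) (T : ℕ) :
    expectation P (fun ω => regret π (ℓ ω) T) ≤ ⨆ ℓ : LossSeq K, regret π ℓ T :=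
  (expectation_mono P fun ω => le_ciSup (bddAbove_regret π T) (ℓ ω)).trans_eq
    (expectation_const P _)

end Regret

section Exp3

variable {K d : ℕ} {η : ℝ} {y : ℕ → Fin K → ℝ}

/-- The distribution from which Exp3 draws the action of round `t`. -/
noncomputable def exp3Prob (d : ℕ) (η : ℝ) (y : ℕ → Fin K → ℝ) (t : ℕ) (i : Fin K) : ℝ :=
  exp3Weight d η y t i / ∑ j, exp3Weight d η y t j

/-- The importance-weighted estimate of the loss of action `i` in round `t`. It is attached to the
round it estimates, not to the round `t + d` in which Exp3 makes use of it. -/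
noncomputable def lossEst (d : ℕ) (η : ℝ) (y : ℕ → Fin K → ℝ) (t : ℕ) (i : Fin K) : ℝ :=
  y t i / exp3Prob d η y t i

theorem exp3Weight_succ_of_lt {t : ℕ} (h : t < d) (i : Fin K) :
    exp3Weight d η y (t + 1) i = exp3Prob d η y t i := by
  rw [exp3Weight]
  beta_reduce
  rw [if_neg (by omega), mul_zero, Real.exp_zero, mul_one, exp3Prob]

theorem exp3Weight_add_succ (d : ℕ) (η : ℝ) (y : ℕ → Fin K → ℝ) (t : ℕ) (i : Fin K) :
    exp3Weight d η y (t + d + 1) i =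
      exp3Prob d η y (t + d) i * Real.exp (-(η * lossEst d η y t i)) := by
  rw [exp3Weight]
  beta_reduce
  rw [if_pos (by omega), Nat.add_sub_cancel, neg_mul]
  rfl

theorem exp3Weight_congr {y' : ℕ → Fin K → ℝ} {t : ℕ} (h : ∀ s, s + d < t → y s = y' s) :
    exp3Weight d η y t = exp3Weight d η y' t := by
  induction t using Nat.strong_induction_on with
  | _ t ih =>
    cases t with
    | zero => funext i; simp only [exp3Weight]
    | succ t =>
      funext i
      rw [exp3Weight, exp3Weight, ih t (by omega) fun s hs => h s (by omega),
        ih (t - d) (by omega) fun s hs => h s (by omega)]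
      by_cases hd : d ≤ t
      · rw [h (t - d) (by omega)]
      · simp only [if_neg hd]

theorem exp3Prob_congr {y' : ℕ → Fin K → ℝ} {t : ℕ} (h : ∀ s, s + d < t → y s = y' s) :
    exp3Prob d η y t = exp3Prob d η y' t := by
  unfold exp3Prob
  rw [exp3Weight_congr h]

theorem sum_exp3Weight_pos (hK : 0 < K) (d : ℕ) (η : ℝ) (y : ℕ → Fin K → ℝ) (t : ℕ) :
    0 < ∑ j, exp3Weight d η y t j :=
  Finset.sum_pos (fun j _ => exp3Weight_pos d η y t j) ⟨⟨0, hK⟩, Finset.mem_univ _⟩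

theorem exp3Prob_pos (d : ℕ) (η : ℝ) (y : ℕ → Fin K → ℝ) (t : ℕ) (i : Fin K) :
    0 < exp3Prob d η y t i :=
  div_pos (exp3Weight_pos d η y t i) (sum_exp3Weight_pos i.pos d η y t)

theorem sum_exp3Prob (hK : 0 < K) (d : ℕ) (η : ℝ) (y : ℕ → Fin K → ℝ) (t : ℕ) :
    ∑ i, exp3Prob d η y t i = 1 := by
  unfold exp3Prob
  rw [← Finset.sum_div, div_self (sum_exp3Weight_pos hK d η y t).ne']

theorem exp3Prob_le_one (d : ℕ) (η : ℝ) (y : ℕ → Fin K → ℝ) (t : ℕ) (i : Fin K) :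
    exp3Prob d η y t i ≤ 1 := by
  rw [← sum_exp3Prob i.pos d η y t]
  exact Finset.single_le_sum (fun j _ => (exp3Prob_pos d η y t j).le) (Finset.mem_univ i)

theorem exp3Prob_succ_of_lt {t : ℕ} (h : t < d) (i : Fin K) :
    exp3Prob d η y (t + 1) i = exp3Prob d η y t i := by
  conv_lhs => rw [exp3Prob]
  simp only [exp3Weight_succ_of_lt h, sum_exp3Prob i.pos, div_one]

theorem exp3Prob_of_le {t : ℕ} (h : t ≤ d) (i : Fin K) : exp3Prob d η y t i = (K : ℝ)⁻¹ := by
  induction t with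
  | zero => simp [exp3Prob, exp3Weight]
  | succ t ih => rw [exp3Prob_succ_of_lt h, ih (by omega)]

theorem lossEst_nonneg (d : ℕ) (η : ℝ) (hy : ∀ s i, 0 ≤ y s i) (t : ℕ) (i : Fin K) :
    0 ≤ lossEst d η y t i :=
  div_nonneg (hy t i) (exp3Prob_pos d η y t i).le

theorem exp3Prob_mul_lossEst (d : ℕ) (η : ℝ) (y : ℕ → Fin K → ℝ) (t : ℕ) (i : Fin K) :
    exp3Prob d η y t i * lossEst d η y t i = y t i :=
  mul_div_cancel₀ _ (exp3Prob_pos d η y t i).ne'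

theorem exp3Weight_add_succ_le (hη : 0 ≤ η) (hy : ∀ s i, 0 ≤ y s i) (t : ℕ) (i : Fin K) :
    exp3Weight d η y (t + d + 1) i ≤ exp3Prob d η y (t + d) i := by
  rw [exp3Weight_add_succ]
  exact mul_le_of_le_one_right (exp3Prob_pos d η y _ i).le
    (Real.exp_le_one_iff.2 (neg_nonpos.2 (mul_nonneg hη (lossEst_nonneg d η hy t i))))

theorem le_exp3Weight_add_succ (d : ℕ) (η : ℝ) (y : ℕ → Fin K → ℝ) (t : ℕ) (i : Fin K) :
    exp3Prob d η y (t + d) i - η * (exp3Prob d η y (t + d) i * lossEst d η y t i) ≤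
      exp3Weight d η y (t + d + 1) i := by
  rw [exp3Weight_add_succ]
  nlinarith [exp3Prob_pos d η y (t + d) i, Real.one_sub_le_exp_neg (η * lossEst d η y t i)]

theorem exp3Weight_add_succ_le_exp3Prob (hη : 0 ≤ η) (hy : ∀ s i, 0 ≤ y s i) (t : ℕ)
    (i : Fin K) : exp3Weight d η y (t + d + 1) i ≤ exp3Prob d η y (t + d + 1) i := by
  have hsum : ∑ j, exp3Weight d η y (t + d + 1) j ≤ 1 := by
    rw [← sum_exp3Prob i.pos d η y (t + d)]
    exact Finset.sum_le_sum fun j _ => exp3Weight_add_succ_le hη hy t j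
  rw [exp3Prob, le_div_iff₀ (sum_exp3Weight_pos i.pos d η y _)]
  exact mul_le_of_le_one_right (exp3Weight_pos d η y _ i).le hsum

theorem sum_exp3Prob_add_mul_lossEst_le {t : ℕ} (hy : ∀ s i, 0 ≤ y s i)
    (hysum : ∀ s, ∑ i, y s i ≤ 1)
    (h : ∀ i, exp3Prob d η y (t + d) i ≤ 2 * exp3Prob d η y t i) :
    ∑ i, exp3Prob d η y (t + d) i * lossEst d η y t i ≤ 2 := by
  calc ∑ i, exp3Prob d η y (t + d) i * lossEst d η y t i
      ≤ ∑ i, 2 * y t i := Finset.sum_le_sum fun i _ => by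
        rw [← exp3Prob_mul_lossEst d η y t i, ← mul_assoc]
        exact mul_le_mul_of_nonneg_right (h i) (lossEst_nonneg d η hy t i)
    _ ≤ 2 := by rw [← Finset.mul_sum]; linarith [hysum t]

theorem exp3Prob_add_le_of_succ_mul_le {t : ℕ} (hη : 0 ≤ η) (hd : 4 * η * (d + 1) ≤ 1)
    {i : Fin K}
    (h : ∀ r < t + d, exp3Prob d η y (r + 1) i * (1 - 2 * η) ≤ exp3Prob d η y r i) :
    exp3Prob d η y (t + d) i ≤ 2 * exp3Prob d η y t i := by
  have hηd : 0 ≤ η * d := mul_nonneg hη d.cast_nonneg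
  have hstep : 0 ≤ 1 - 2 * η := by linarith
  have hiterate : ∀ m ≤ d,
      exp3Prob d η y (t + m) i * (1 - 2 * η) ^ m ≤ exp3Prob d η y t i := by
    intro m
    induction m with
    | zero => simp
    | succ m ih =>
      intro hm
      refine le_trans ?_ (ih (by omega))
      rw [pow_succ', ← mul_assoc]
      exact mul_le_mul_of_nonneg_right (h (t + m) (by omega)) (pow_nonneg hstep _)
  have hbernoulli : 1 / 2 ≤ (1 - 2 * η) ^ d := by
    have := one_add_mul_le_pow (a := -(2 * η)) (by linarith) d
    rw [← sub_eq_add_neg (1 : ℝ) (2 * η)] at this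
    linarith
  nlinarith [hiterate d le_rfl, exp3Prob_pos d η y (t + d) i]

/-- A round changes the probabilities little since the estimate it makes use of, divided by a
probability `d` rounds old, has a bounded mean under the current probabilities; this in turn holds
since the rounds in between changed them little. -/
theorem exp3Prob_succ_mul_le (hη : 0 ≤ η) (hd : 4 * η * (d + 1) ≤ 1) (hy : ∀ s i, 0 ≤ y s i)
    (hysum : ∀ s, ∑ i, y s i ≤ 1) (t : ℕ) (i : Fin K) :
    exp3Prob d η y (t + 1) i * (1 - 2 * η) ≤ exp3Prob d η y t i := by
  induction t using Nat.strong_induction_on generalizing i with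
  | _ t ih =>
    rcases lt_or_ge t d with h | h
    · rw [exp3Prob_succ_of_lt h]
      nlinarith [exp3Prob_pos d η y t i]
    · obtain ⟨s, rfl⟩ := Nat.exists_eq_add_of_le' h
      have hmean := sum_exp3Prob_add_mul_lossEst_le hy hysum fun j =>
        exp3Prob_add_le_of_succ_mul_le hη hd fun r hr => ih r hr j
      have hsum : 1 - 2 * η ≤ ∑ j, exp3Weight d η y (s + d + 1) j := by
        have := Finset.sum_le_sum fun j (_ : j ∈ Finset.univ) => le_exp3Weight_add_succ d η y s j
        rw [Finset.sum_sub_distrib, sum_exp3Prob i.pos, ← Finset.mul_sum] at this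
        nlinarith
      calc exp3Prob d η y (s + d + 1) i * (1 - 2 * η)
          ≤ exp3Prob d η y (s + d + 1) i * ∑ j, exp3Weight d η y (s + d + 1) j :=
            mul_le_mul_of_nonneg_left hsum (exp3Prob_pos d η y _ i).le
        _ = exp3Weight d η y (s + d + 1) i :=
            div_mul_cancel₀ _ (sum_exp3Weight_pos i.pos d η y _).ne'
        _ ≤ exp3Prob d η y (s + d) i := exp3Weight_add_succ_le hη hy s i

theorem exp3Prob_add_le_two_mul (hη : 0 ≤ η) (hd : 4 * η * (d + 1) ≤ 1)
    (hy : ∀ s i, 0 ≤ y s i) (hysum : ∀ s, ∑ i, y s i ≤ 1) (t : ℕ) (i : Fin K) :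
    exp3Prob d η y (t + d) i ≤ 2 * exp3Prob d η y t i :=
  exp3Prob_add_le_of_succ_mul_le hη hd fun r _ => exp3Prob_succ_mul_le hη hd hy hysum r i

theorem sum_exp3Prob_sub_succ_mul_le (hη : 0 ≤ η) (hd : 4 * η * (d + 1) ≤ 1)
    (hy : ∀ s i, 0 ≤ y s i) (hysum : ∀ s, ∑ i, y s i ≤ 1) (l : Fin K → Set.Icc (0 : ℝ) 1)
    (t : ℕ) :
    ∑ i, (exp3Prob d η y t i - exp3Prob d η y (t + 1) i) * l i ≤ 2 * η := by
  rcases lt_or_ge t d with h | h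
  · simp only [exp3Prob_succ_of_lt h, sub_self, zero_mul, Finset.sum_const_zero]
    linarith
  · obtain ⟨s, rfl⟩ := Nat.exists_eq_add_of_le' h
    have hterm : ∀ i, (exp3Prob d η y (s + d) i - exp3Prob d η y (s + d + 1) i) * l i ≤
        η * (exp3Prob d η y (s + d) i * lossEst d η y s i) := fun i =>
      calc (exp3Prob d η y (s + d) i - exp3Prob d η y (s + d + 1) i) * l i
          ≤ η * (exp3Prob d η y (s + d) i * lossEst d η y s i) * l i :=
            mul_le_mul_of_nonneg_right (by linarith [le_exp3Weight_add_succ d η y s i,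
              exp3Weight_add_succ_le_exp3Prob (d := d) hη hy s i]) (l i).2.1
        _ ≤ η * (exp3Prob d η y (s + d) i * lossEst d η y s i) :=
            mul_le_of_le_one_right (mul_nonneg hη (mul_nonneg (exp3Prob_pos d η y _ i).le
              (lossEst_nonneg d η hy s i))) (l i).2.2
    refine (Finset.sum_le_sum fun i _ => hterm i).trans ?_
    rw [← Finset.mul_sum]
    nlinarith [sum_exp3Prob_add_mul_lossEst_le hy hysum (exp3Prob_add_le_two_mul hη hd hy hysum s)]

theorem sum_exp3Prob_mul_le_add (hη : 0 ≤ η) (hd : 4 * η * (d + 1) ≤ 1)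
    (hy : ∀ s i, 0 ≤ y s i) (hysum : ∀ s, ∑ i, y s i ≤ 1) (l : Fin K → Set.Icc (0 : ℝ) 1)
    (t m : ℕ) :
    ∑ i, exp3Prob d η y t i * l i ≤ ∑ i, exp3Prob d η y (t + m) i * l i + 2 * η * m := by
  induction m with
  | zero => simp
  | succ m ih =>
    have hstep := sum_exp3Prob_sub_succ_mul_le hη hd hy hysum l (t + m)
    simp only [sub_mul, Finset.sum_sub_distrib] at hstep
    push_cast
    rw [← add_assoc]
    linarith

theorem exp_neg_le_quadratic_of_nonneg {x : ℝ} (hx : 0 ≤ x) :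
    Real.exp (-x) ≤ 1 - x + x ^ 2 / 2 := by
  have hquad := Real.quadratic_le_exp_of_nonneg hx
  rw [Real.exp_neg, inv_le_iff_one_le_mul₀ (Real.exp_pos x)]
  nlinarith [sq_nonneg (x - 1), sq_nonneg (x ^ 2)]

theorem exp3Prob_add_mul_lossEst_sq_le (hη : 0 ≤ η) (hd : 4 * η * (d + 1) ≤ 1)
    (hy : ∀ s i, 0 ≤ y s i) (hysum : ∀ s, ∑ i, y s i ≤ 1) (t : ℕ) (i : Fin K) :
    exp3Prob d η y (t + d) i * lossEst d η y t i ^ 2 ≤ 2 * lossEst d η y t i := by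
  have hyi : y t i ≤ 1 :=
    (Finset.single_le_sum (fun j _ => hy t j) (Finset.mem_univ i)).trans (hysum t)
  calc exp3Prob d η y (t + d) i * lossEst d η y t i ^ 2
      ≤ 2 * exp3Prob d η y t i * lossEst d η y t i ^ 2 :=
        mul_le_mul_of_nonneg_right (exp3Prob_add_le_two_mul hη hd hy hysum t i) (sq_nonneg _)
    _ = 2 * (y t i * lossEst d η y t i) := by rw [← exp3Prob_mul_lossEst d η y t i]; ring
    _ ≤ 2 * lossEst d η y t i := by nlinarith [lossEst_nonneg d η hy t i]

theorem log_sum_exp3Weight_le (hη : 0 ≤ η) (hd : 4 * η * (d + 1) ≤ 1)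
    (hy : ∀ s i, 0 ≤ y s i) (hysum : ∀ s, ∑ i, y s i ≤ 1) (hK : 0 < K) (t : ℕ) :
    Real.log (∑ i, exp3Weight d η y (t + d + 1) i) ≤
      η ^ 2 * ∑ i, lossEst d η y t i -
        η * ∑ i, exp3Prob d η y (t + d) i * lossEst d η y t i := by
  have hterm : ∀ i, exp3Weight d η y (t + d + 1) i ≤ exp3Prob d η y (t + d) i +
      η ^ 2 * lossEst d η y t i - η * (exp3Prob d η y (t + d) i * lossEst d η y t i) := fun i => by
    rw [exp3Weight_add_succ]
    have hexp := mul_le_mul_of_nonneg_left (exp_neg_le_quadratic_of_nonneg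
      (mul_nonneg hη (lossEst_nonneg d η hy t i))) (exp3Prob_pos d η y (t + d) i).le
    nlinarith [mul_le_mul_of_nonneg_left (exp3Prob_add_mul_lossEst_sq_le hη hd hy hysum t i)
      (sq_nonneg η)]
  have hsum := Finset.sum_le_sum fun i (_ : i ∈ Finset.univ) => hterm i
  rw [Finset.sum_sub_distrib, Finset.sum_add_distrib, sum_exp3Prob hK, ← Finset.mul_sum,
    ← Finset.mul_sum] at hsum
  linarith [Real.log_le_sub_one_of_pos (sum_exp3Weight_pos hK d η y (t + d + 1))]

theorem log_exp3Prob_add_succ (d : ℕ) (η : ℝ) (y : ℕ → Fin K → ℝ) (t : ℕ) (k : Fin K) :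
    Real.log (exp3Prob d η y (t + d + 1) k) = Real.log (exp3Prob d η y (t + d) k) -
      η * lossEst d η y t k - Real.log (∑ j, exp3Weight d η y (t + d + 1) j) := by
  rw [exp3Prob, Real.log_div (exp3Weight_pos d η y _ k).ne' (sum_exp3Weight_pos k.pos d η y _).ne',
    exp3Weight_add_succ, Real.log_mul (exp3Prob_pos d η y _ k).ne' (Real.exp_pos _).ne',
    Real.log_exp, ← sub_eq_add_neg]

/-- The logarithm of the probability of action `k` serves as the potential. -/
theorem sum_exp3Prob_add_mul_lossEst_le_sum_lossEst_add (hη : 0 < η)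
    (hd : 4 * η * (d + 1) ≤ 1) (hy : ∀ s i, 0 ≤ y s i) (hysum : ∀ s, ∑ i, y s i ≤ 1) (T : ℕ)
    (k : Fin K) :
    ∑ t : Fin T, ∑ i, exp3Prob d η y (t + d) i * lossEst d η y t i ≤
      ∑ t : Fin T, lossEst d η y t k + η * ∑ t : Fin T, ∑ i, lossEst d η y t i +
        Real.log K / η := by
  have hstep : ∀ t, η * (∑ i, exp3Prob d η y (t + d) i * lossEst d η y t i -
      lossEst d η y t k - η * ∑ i, lossEst d η y t i) ≤
      Real.log (exp3Prob d η y (t + 1 + d) k) - Real.log (exp3Prob d η y (t + d) k) := fun t => by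
    rw [add_right_comm, log_exp3Prob_add_succ]
    linarith [log_sum_exp3Weight_le hη.le hd hy hysum k.pos t]
  have htel := Finset.sum_le_sum fun t (_ : t ∈ Finset.range T) => hstep t
  rw [Finset.sum_range_sub (fun t => Real.log (exp3Prob d η y (t + d) k)), zero_add,
    exp3Prob_of_le le_rfl, Real.log_inv, ← Finset.mul_sum, Finset.sum_sub_distrib,
    Finset.sum_sub_distrib, ← Finset.mul_sum] at htel
  simp only [Finset.sum_range] at htel
  have hlast := Real.log_nonpos (exp3Prob_pos d η y (T + d) k).le (exp3Prob_le_one d η y _ k)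
  linarith [(le_div_iff₀' hη).2 (htel.trans (show _ ≤ Real.log K by linarith))]

end Exp3

section Exp3Regret

variable {K d T : ℕ} {η : ℝ} {ℓ : LossSeq K}

/-- The losses suffered along the path `a`, listed by round and action as `exp3Weight` takes
them. -/
noncomputable def playedLoss (ℓ : LossSeq K) (a : Fin T → Fin K) (s : ℕ) (i : Fin K) : ℝ :=
  if h : s < T then (if a ⟨s, h⟩ = i then (ℓ s i : ℝ) else 0) else 0

theorem playedLoss_nonneg (ℓ : LossSeq K) (a : Fin T → Fin K) (s : ℕ) (i : Fin K) :
    0 ≤ playedLoss ℓ a s i := by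
  unfold playedLoss
  split_ifs
  exacts [(ℓ s i).2.1, le_rfl, le_rfl]

theorem sum_playedLoss_le_one (ℓ : LossSeq K) (a : Fin T → Fin K) (s : ℕ) :
    ∑ i, playedLoss ℓ a s i ≤ 1 := by
  unfold playedLoss
  by_cases h : s < T
  · simpa [h] using (ℓ s (a ⟨s, h⟩)).2.2
  · simp [h]

theorem playedLoss_past (ℓ : LossSeq K) (a : Fin T → Fin K) (t : Fin T) {s : ℕ} (h : s < t) :
    playedLoss ℓ (past a t) s = playedLoss ℓ a s := by
  funext i
  rw [playedLoss, playedLoss, dif_pos h, dif_pos (h.trans t.isLt)]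
  rfl

theorem playedLoss_apply (ℓ : LossSeq K) (a : Fin T → Fin K) (t : Fin T) (i : Fin K) :
    playedLoss ℓ a t i = if a t = i then (ℓ t i : ℝ) else 0 := by
  simp only [playedLoss, t.isLt, dif_pos]

theorem actionKernel_exp3_apply (hK : 0 < K) (n : ℕ) (h : Fin n → Fin K) (i : Fin K) :
    actionKernel (exp3 hK d η) ℓ n h i = exp3Prob d η (playedLoss ℓ h) n i := by
  change exp3Prob d η _ n i = _
  refine congrFun (exp3Prob_congr fun s hs => ?_) i
  have hrevealed : s < n - d := by omega
  have hplayed : s < n := by omega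
  funext j
  simp only [playedLoss, hrevealed, hplayed, dif_pos]
  split_ifs with hj
  · rw [hj]
  · rfl

theorem exp3Prob_playedLoss_past (ℓ : LossSeq K) (a : Fin T → Fin K) (t : Fin T) {r : ℕ}
    (hr : r ≤ t + d) :
    exp3Prob d η (playedLoss ℓ (past a t)) r = exp3Prob d η (playedLoss ℓ a) r :=
  exp3Prob_congr fun _ _ => playedLoss_past ℓ a t (by omega)

/-- The law of the first `T` actions of Exp3 against the losses `ℓ`. -/
noncomputable abbrev exp3Law (hK : 0 < K) (d : ℕ) (η : ℝ) (ℓ : LossSeq K) (T : ℕ) :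
    stdSimplex ℝ (Fin T → Fin K) :=
  seqLaw (actionKernel (exp3 hK d η) ℓ) T

theorem expectation_mul_lossEst (hK : 0 < K) (t : Fin T) (i : Fin K)
    (F : (Fin t → Fin K) → ℝ) :
    expectation (exp3Law hK d η ℓ T)
        (fun a => F (past a t) * lossEst d η (playedLoss ℓ a) t i) =
      expectation (exp3Law hK d η ℓ T) fun a => F (past a t) * ℓ t i := by
  have hpast : ∀ a : Fin T → Fin K, lossEst d η (playedLoss ℓ a) t i =
      (if a t = i then (ℓ t i : ℝ) else 0) / exp3Prob d η (playedLoss ℓ (past a t)) t i :=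
    fun a => by rw [lossEst, playedLoss_apply, exp3Prob_playedLoss_past ℓ a t (by omega)]
  simp only [hpast]
  rw [expectation_seqLaw_condExp _ t fun h x =>
    F h * ((if x = i then (ℓ t i : ℝ) else 0) / exp3Prob d η (playedLoss ℓ h) t i)]
  congr 1
  funext a
  have hp := (exp3Prob_pos d η (playedLoss ℓ (past a t)) t i).ne'
  rw [expectation, Finset.sum_eq_single i (fun j _ hj => by simp [hj]) (by simp), if_pos rfl,
    actionKernel_exp3_apply, mul_left_comm, mul_div_cancel₀ _ hp]

theorem expectation_lossEst (hK : 0 < K) (t : Fin T) (i : Fin K) :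
    expectation (exp3Law hK d η ℓ T) (fun a => lossEst d η (playedLoss ℓ a) t i) = ℓ t i := by
  simpa only [one_mul, expectation_const] using
    expectation_mul_lossEst (d := d) (η := η) (ℓ := ℓ) hK t i fun _ => 1

theorem expectedLoss_exp3 (hK : 0 < K) (d : ℕ) (η : ℝ) (ℓ : LossSeq K) (T : ℕ) :
    expectedLoss (exp3 hK d η) ℓ T = expectation (exp3Law hK d η ℓ T) fun a =>
      ∑ t : Fin T, ∑ i, exp3Prob d η (playedLoss ℓ a) t i * ℓ t i := by
  rw [expectedLoss_eq_expectation, expectation_sum, expectation_sum]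
  refine Finset.sum_congr rfl fun t _ => ?_
  rw [expectation_seqLaw_apply _ t fun x => (ℓ t x : ℝ)]
  congr 1
  funext a
  refine Finset.sum_congr rfl fun i _ => ?_
  rw [actionKernel_exp3_apply, exp3Prob_playedLoss_past ℓ a t (by omega)]

/-- When the loss of round `t` is used, in round `t + d`, the probabilities of that round are still
determined by the actions before round `t`; hence the estimate is unbiased under them. -/
theorem expectation_sum_exp3Prob_add_mul_lossEst (hK : 0 < K) (d : ℕ) (η : ℝ) (ℓ : LossSeq K)
    (T : ℕ) :
    expectation (exp3Law hK d η ℓ T) (fun a => ∑ t : Fin T, ∑ i,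
        exp3Prob d η (playedLoss ℓ a) (t + d) i * lossEst d η (playedLoss ℓ a) t i) =
      expectation (exp3Law hK d η ℓ T) fun a =>
        ∑ t : Fin T, ∑ i, exp3Prob d η (playedLoss ℓ a) (t + d) i * ℓ t i := by
  simp only [expectation_sum]
  refine Finset.sum_congr rfl fun t _ => Finset.sum_congr rfl fun i _ => ?_
  simpa only [exp3Prob_playedLoss_past ℓ _ t le_rfl] using
    expectation_mul_lossEst (d := d) (η := η) (ℓ := ℓ) hK t i fun h =>
      exp3Prob d η (playedLoss ℓ h) (t + d) i

theorem expectedLoss_exp3_le_delayed (hK : 0 < K) (hη : 0 ≤ η) (hd : 4 * η * (d + 1) ≤ 1)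
    (ℓ : LossSeq K) (T : ℕ) :
    expectedLoss (exp3 hK d η) ℓ T ≤ expectation (exp3Law hK d η ℓ T) (fun a =>
      ∑ t : Fin T, ∑ i, exp3Prob d η (playedLoss ℓ a) (t + d) i * ℓ t i) + 2 * η * d * T := by
  rw [expectedLoss_exp3, ← expectation_const (exp3Law hK d η ℓ T) (2 * η * d * T),
    ← expectation_add]
  refine expectation_mono _ fun a => ?_
  refine (Finset.sum_le_sum fun (t : Fin T) _ => sum_exp3Prob_mul_le_add hη hd
    (playedLoss_nonneg ℓ a) (sum_playedLoss_le_one ℓ a) (ℓ t) t d).trans_eq ?_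
  rw [Finset.sum_add_distrib, Fin.sum_const, nsmul_eq_mul, mul_comm (T : ℝ)]

theorem expectedLoss_exp3_le (hK : 0 < K) (hη : 0 < η) (hd : 4 * η * (d + 1) ≤ 1)
    (ℓ : LossSeq K) (T : ℕ) (k : Fin K) :
    expectedLoss (exp3 hK d η) ℓ T ≤ ∑ t ∈ Finset.range T, (ℓ t k : ℝ) +
      (Real.log K / η + 2 * η * ((K + d) * T)) := by
  have hdelayed := expectedLoss_exp3_le_delayed hK hη.le hd ℓ T
  rw [← expectation_sum_exp3Prob_add_mul_lossEst] at hdelayed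
  have hweights := expectation_mono (exp3Law hK d η ℓ T) fun a =>
    sum_exp3Prob_add_mul_lossEst_le_sum_lossEst_add hη hd (playedLoss_nonneg ℓ a)
      (sum_playedLoss_le_one ℓ a) T k
  simp only [expectation_add, expectation_const_mul, expectation_sum, expectation_lossEst,
    expectation_const] at hweights hdelayed
  have htotal : ∑ t : Fin T, ∑ i, (ℓ t i : ℝ) ≤ T * K := by
    calc ∑ t : Fin T, ∑ i, (ℓ t i : ℝ) ≤ ∑ _t : Fin T, ∑ _i : Fin K, (1 : ℝ) :=
          Finset.sum_le_sum fun t _ => Finset.sum_le_sum fun i _ => (ℓ t i).2.2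
      _ = T * K := by simp
  have hKT : 0 ≤ η * (K * T) := by positivity
  rw [Finset.sum_range]
  linarith [mul_le_mul_of_nonneg_left htotal hη.le]

theorem regret_exp3_le (hK : 0 < K) (hη : 0 < η) (hd : 4 * η * (d + 1) ≤ 1) (ℓ : LossSeq K)
    (T : ℕ) :
    regret (exp3 hK d η) ℓ T ≤ Real.log K / η + 2 * η * ((K + d) * T) := by
  have : Nonempty (Fin K) := ⟨⟨0, hK⟩⟩
  have hbest := le_ciInf fun k => sub_le_iff_le_add.2 (expectedLoss_exp3_le hK hη hd ℓ T k)
  exact sub_le_comm.1 hbest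

/-- The learning rate `log K / (4 √((K + d) T log K))` balances the two terms of `regret_exp3_le`.
It is too large for that lemma if `T ≤ (K + d) log K`, but then the trivial bound `T` suffices. -/
theorem exists_regret_exp3_le (hK : 2 ≤ K) (d T : ℕ) :
    ∃ η : ℝ, 0 < η ∧ ∀ ℓ : LossSeq K, regret (exp3 (Nat.zero_lt_of_lt hK) d η) ℓ T ≤
      5 * √(((K : ℝ) + d) * T * Real.log K) := by
  have hK' : (2 : ℝ) ≤ K := Nat.ofNat_le_cast.2 hK
  have : (0 : ℝ) ≤ d := d.cast_nonneg
  have hlog : 0 < Real.log K := Real.log_pos (by linarith)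
  have hKd : 0 < (K + d) * Real.log K := by positivity
  set S := √(((K : ℝ) + d) * T * Real.log K)
  rcases le_or_gt (T : ℝ) ((K + d) * Real.log K) with hT | hT
  · have hTS : (T : ℝ) ≤ S := Real.le_sqrt_of_sq_le (by nlinarith [T.cast_nonneg (α := ℝ)])
    exact ⟨1, one_pos, fun ℓ => (regret_le_length _ ℓ T).trans
      (by linarith [T.cast_nonneg (α := ℝ)])⟩
  · have hS : 0 < S := Real.sqrt_pos.2 (by nlinarith)
    have hSsq : S ^ 2 = (K + d) * T * Real.log K := Real.sq_sqrt (by positivity)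
    have hKdS : (K + d) * Real.log K ≤ S := Real.le_sqrt_of_sq_le (by nlinarith)
    have hsmall : 4 * (Real.log K / (4 * S)) * ((d : ℝ) + 1) ≤ 1 := by
      rw [show 4 * (Real.log K / (4 * S)) * ((d : ℝ) + 1) = ((d + 1) * Real.log K) / S by
        field_simp, div_le_one hS]
      nlinarith
    have hfirst : Real.log K / (Real.log K / (4 * S)) = 4 * S := by field_simp
    have hsecond : 2 * (Real.log K / (4 * S)) * ((K + d) * T) = S / 2 := by
      field_simp
      linarith
    refine ⟨Real.log K / (4 * S), by positivity, fun ℓ =>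
      (regret_exp3_le _ (by positivity) hsmall ℓ T).trans ?_⟩
    rw [hfirst, hsecond]
    linarith

theorem minimaxRegret_le_min_sqrt (hK : 2 ≤ K) (d T : ℕ) :
    minimaxRegret K d T ≤ 5 * min (T : ℝ) (√(((K : ℝ) + d) * T * Real.log K)) := by
  obtain ⟨η, -, hη⟩ := exists_regret_exp3_le hK d T
  have hlength := minimaxRegret_le_length (Nat.zero_lt_of_lt hK) d T
  rw [mul_min_of_nonneg _ _ (by norm_num)]
  exact le_min (by linarith [T.cast_nonneg (α := ℝ)]) (minimaxRegret_le _ hη)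

end Exp3Regret

section StochasticBandit

variable {K d T : ℕ} {β : Type*}

/-- The losses of the first `T` rounds given by a table `ω` of outcomes, whose entry `ω t i` costs
`v (ω t i)`; the later losses, of no importance, are `0`. -/
noncomputable def tableLoss (v : β → Set.Icc (0 : ℝ) 1) (ω : Fin T → Fin K → β) : LossSeq K :=
  fun t i => if h : t < T then v (ω ⟨t, h⟩ i) else 0

theorem tableLoss_apply (v : β → Set.Icc (0 : ℝ) 1) (ω : Fin T → Fin K → β) (t : Fin T)
    (i : Fin K) : tableLoss v ω t i = v (ω t i) := by
  simp only [tableLoss, t.isLt, dif_pos]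

theorem tableLoss_snoc (v : β → Set.Icc (0 : ℝ) 1) (ω : Fin T → Fin K → β) (r : Fin K → β)
    {s : ℕ} (hs : s < T) :
    tableLoss v (Fin.snoc ω r : Fin (T + 1) → Fin K → β) s = tableLoss v ω s := by
  funext i
  rw [tableLoss, tableLoss, dif_pos hs, dif_pos (hs.trans T.lt_succ_self)]
  exact congrArg (fun row : Fin K → β => v (row i))
    (Fin.snoc_castSucc (α := fun _ => Fin K → β) r ω ⟨s, hs⟩)

variable [Fintype β]

/-- The law of a table of independent outcomes, those of action `i` having the law `μ i`. -/
noncomputable abbrev tableLaw (μ : Fin K → stdSimplex ℝ β) (T : ℕ) :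
    stdSimplex ℝ (Fin T → Fin K → β) :=
  seqLaw (fun _ _ => piLaw μ) T

/-- The pairs of an action and its outcome seen in a stochastic bandit, as a transition rule with
memory: the strategy `π` draws the action, and the outcome of action `i`, which costs it `v` of the
outcome, has the law `μ i`. -/
noncomputable def playKernel (π : Strategy K d) (v : β → Set.Icc (0 : ℝ) 1)
    (μ : Fin K → stdSimplex ℝ β) : SeqKernel (Fin K × β) :=
  fun n z => compProd
    (π n (fun s => (z s).1) fun s => v (z ⟨s, s.isLt.trans_le (Nat.sub_le _ _)⟩).2) μ

theorem actionKernel_tableLoss (π : Strategy K d) (v : β → Set.Icc (0 : ℝ) 1)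
    (μ : Fin K → stdSimplex ℝ β) (ω : Fin T → Fin K → β) (a : Fin T → Fin K) :
    compProd (actionKernel π (tableLoss v ω) T a) μ =
      playKernel π v μ T fun t => (a t, ω t (a t)) := by
  unfold playKernel actionKernel
  congr 2
  funext s
  exact congrArg Subtype.val (tableLoss_apply v ω ⟨s, s.isLt.trans_le (Nat.sub_le _ _)⟩ _)

/-- Outcomes that are never seen may be drawn in advance. -/
theorem expectation_tableLaw_seqLaw (π : Strategy K d) (v : β → Set.Icc (0 : ℝ) 1)
    (μ : Fin K → stdSimplex ℝ β) (T : ℕ) (G : (Fin T → Fin K × β) → ℝ) :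
    expectation (tableLaw μ T) (fun ω =>
        expectation (seqLaw (actionKernel π (tableLoss v ω)) T) fun a =>
          G fun t => (a t, ω t (a t))) =
      expectation (seqLaw (playKernel π v μ) T) G := by
  induction T with
  | zero =>
    simp only [expectation, Fintype.sum_unique, seqLaw_apply, pathProb, Fin.prod_univ_zero, one_mul]
    exact congrArg G (Subsingleton.elim _ _)
  | succ n ih =>
    have hsnoc : ∀ (ω : Fin n → Fin K → β) r a x,
        (fun t => ((Fin.snoc a x : Fin (n + 1) → Fin K) t,
          (Fin.snoc ω r : Fin (n + 1) → Fin K → β) t ((Fin.snoc a x : Fin (n + 1) → Fin K) t))) =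
        (Fin.snoc (fun t => (a t, ω t (a t))) (x, r x) : Fin (n + 1) → Fin K × β) := by
      intro ω r a x
      funext t
      induction t using Fin.lastCases <;> simp
    have hrow : ∀ (ω : Fin n → Fin K → β) r, ∀ m ≤ n,
        actionKernel π (tableLoss v (Fin.snoc ω r : Fin (n + 1) → Fin K → β)) m =
          actionKernel π (tableLoss v ω) m := fun ω r m hm =>
      actionKernel_congr π fun s hs => tableLoss_snoc v ω r (by omega)
    rw [expectation_seqLaw_succ, expectation_seqLaw_succ, ← ih]
    congr 1
    funext ω
    simp only [expectation_seqLaw_succ, hsnoc, hrow ω _ n le_rfl,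
      seqLaw_congr fun m hm => hrow ω _ m (le_of_lt hm)]
    rw [expectation_comm]
    congr 1
    funext a
    rw [← actionKernel_tableLoss, expectation_compProd, expectation_comm]
    congr 1
    funext x
    exact expectation_piLaw_apply μ x fun b => G (Fin.snoc (fun t => (a t, ω t (a t))) (x, b))

theorem expectation_playKernel_apply (π : Strategy K d) (v : β → Set.Icc (0 : ℝ) 1)
    (μ : Fin K → stdSimplex ℝ β) (f : Fin K × β → ℝ) (t : Fin T) :
    expectation (seqLaw (playKernel π v μ) T) (fun z => f (z t)) =
      expectation (seqLaw (playKernel π v μ) T) fun z =>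
        expectation (μ (z t).1) fun b => f ((z t).1, b) := by
  rw [expectation_seqLaw_apply _ t f, expectation_seqLaw_apply (playKernel π v μ) t
    fun x : Fin K × β => expectation (μ x.1) fun b => f (x.1, b)]
  simp only [playKernel, expectation_compProd, expectation_const]

theorem expectation_sum_gap_le_iSup_regret (π : Strategy K d) (v : β → Set.Icc (0 : ℝ) 1)
    (μ : Fin K → stdSimplex ℝ β) (T : ℕ) (i : Fin K) :
    expectation (seqLaw (playKernel π v μ) T) (fun z => ∑ t,
        (expectation (μ (z t).1) (fun b => (v b : ℝ)) - expectation (μ i) fun b => (v b : ℝ))) ≤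
      ⨆ ℓ : LossSeq K, regret π ℓ T := by
  have hplayed : expectation (tableLaw μ T) (fun ω => expectedLoss π (tableLoss v ω) T) =
      expectation (seqLaw (playKernel π v μ) T) fun z =>
        ∑ t, expectation (μ (z t).1) fun b => (v b : ℝ) := by
    simp only [expectedLoss_eq_expectation, tableLoss_apply]
    rw [expectation_tableLaw_seqLaw π v μ T fun z => ∑ t, (v (z t).2 : ℝ)]
    simp only [expectation_sum]
    exact Finset.sum_congr rfl fun t _ =>
      expectation_playKernel_apply π v μ (fun x => (v x.2 : ℝ)) t
  have hfixed : expectation (tableLaw μ T)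
      (fun ω => ∑ t ∈ Finset.range T, (tableLoss v ω t i : ℝ)) =
        ∑ _t : Fin T, expectation (μ i) fun b => (v b : ℝ) := by
    simp only [Finset.sum_range, tableLoss_apply, expectation_sum]
    refine Finset.sum_congr rfl fun t _ => ?_
    rw [expectation_seqLaw_apply (fun _ _ => piLaw μ) t fun r : Fin K → β => (v (r i) : ℝ),
      expectation_const, expectation_piLaw_apply μ i fun b => (v b : ℝ)]
  calc _ = expectation (tableLaw μ T) fun ω => expectedLoss π (tableLoss v ω) T -
          ∑ t ∈ Finset.range T, (tableLoss v ω t i : ℝ) := by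
        rw [expectation_sub, hplayed, hfixed]
        simp only [Finset.sum_sub_distrib, expectation_sub, expectation_const]
    _ ≤ expectation (tableLaw μ T) fun ω => regret π (tableLoss v ω) T :=
        expectation_mono _ fun ω => sub_le_sub_left (iInf_sum_loss_le _ T i) _
    _ ≤ ⨆ ℓ : LossSeq K, regret π ℓ T := expectation_regret_le_iSup _ π _ T

theorem playKernel_eq_zero (π : Strategy K d) (v : β → Set.Icc (0 : ℝ) 1)
    {μ ν : Fin K → stdSimplex ℝ β} (h : ∀ i b, ν i b = 0 → μ i b = 0) (n : ℕ)
    (z : Fin n → Fin K × β) (x : Fin K × β) (hx : playKernel π v ν n z x = 0) :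
    playKernel π v μ n z x = 0 :=
  mul_eq_zero.2 ((mul_eq_zero.1 hx).imp_right (h x.1 x.2))

theorem relEntropy_playKernel (π : Strategy K d) (v : β → Set.Icc (0 : ℝ) 1)
    {μ ν : Fin K → stdSimplex ℝ β} (h : ∀ i b, ν i b = 0 → μ i b = 0) (T : ℕ) :
    relEntropy (seqLaw (playKernel π v μ) T) (seqLaw (playKernel π v ν) T) =
      expectation (seqLaw (playKernel π v μ) T) fun z =>
        ∑ t, relEntropy (μ (z t).1) (ν (z t).1) := by
  rw [relEntropy_seqLaw (playKernel_eq_zero π v h)]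
  simp only [expectation_sum]
  refine Finset.sum_congr rfl fun t _ => ?_
  rw [expectation_seqLaw_apply (playKernel π v μ) t
    fun x : Fin K × β => relEntropy (μ x.1) (ν x.1)]
  simp only [playKernel, relEntropy_compProd, expectation_compProd, expectation_const]

end StochasticBandit

section BanditLowerBound

variable {K d T : ℕ} {β : Type*}

/-- The number of rounds in which action `i` was played, for a sequence `z` of pairs of an action
and its outcome. -/
noncomputable def pullCount (i : Fin K) (z : Fin T → Fin K × β) : ℝ :=
  ∑ t, if (z t).1 = i then 1 else 0

theorem pullCount_mem_Icc (i : Fin K) (z : Fin T → Fin K × β) :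
    pullCount i z ∈ Set.Icc (0 : ℝ) T := by
  constructor
  · exact Finset.sum_nonneg fun t _ => by split_ifs <;> norm_num
  · rw [pullCount, Finset.sum_boole]
    exact_mod_cast (Finset.card_le_univ _).trans_eq (Fintype.card_fin T)

theorem sum_pullCount (z : Fin T → Fin K × β) : ∑ i, pullCount i z = T := by
  unfold pullCount
  rw [Finset.sum_comm]
  simp

variable [Fintype β]

theorem exists_expectation_pullCount_le (hK : 0 < K) (P : stdSimplex ℝ (Fin T → Fin K × β)) :
    ∃ i, expectation P (pullCount i) ≤ (T : ℝ) / K := by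
  have : NeZero K := ⟨hK.ne'⟩
  obtain ⟨i, -, hi⟩ := Finset.exists_le_of_sum_le (s := Finset.univ)
    (f := fun i => expectation P (pullCount i)) (g := fun _ => (T : ℝ) / K)
    Finset.univ_nonempty (by
      rw [← expectation_sum]
      simp only [sum_pullCount, expectation_const, Finset.sum_const, Finset.card_univ,
        Fintype.card_fin, nsmul_eq_mul]
      rw [mul_div_cancel₀ _ (Nat.cast_ne_zero.2 hK.ne')])
  exact ⟨i, hi⟩

theorem relEntropy_playKernel_of_eq_off (π : Strategy K d) (v : β → Set.Icc (0 : ℝ) 1)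
    {μ ν : Fin K → stdSimplex ℝ β} {i : Fin K} (h : ∀ j b, ν j b = 0 → μ j b = 0)
    (hoff : ∀ j ≠ i, ν j = μ j) (T : ℕ) :
    relEntropy (seqLaw (playKernel π v μ) T) (seqLaw (playKernel π v ν) T) =
      relEntropy (μ i) (ν i) * expectation (seqLaw (playKernel π v μ) T) (pullCount i) := by
  rw [relEntropy_playKernel π v h, ← expectation_const_mul]
  congr 1
  funext z
  rw [pullCount, Finset.mul_sum]
  refine Finset.sum_congr rfl fun t _ => ?_
  split_ifs with hi
  · rw [hi, mul_one]
  · rw [hoff _ hi, relEntropy_self, mul_zero]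

theorem expectation_pullCount_le_add_sqrt (π : Strategy K d) (v : β → Set.Icc (0 : ℝ) 1)
    {μ ν : Fin K → stdSimplex ℝ β} {i : Fin K} (h : ∀ j b, ν j b = 0 → μ j b = 0)
    (hoff : ∀ j ≠ i, ν j = μ j) (T : ℕ) :
    expectation (seqLaw (playKernel π v ν) T) (pullCount i) ≤
      expectation (seqLaw (playKernel π v μ) T) (pullCount i) + T * √(relEntropy (μ i) (ν i) *
        expectation (seqLaw (playKernel π v μ) T) (pullCount i)) := by
  rw [← relEntropy_playKernel_of_eq_off π v h hoff]
  exact expectation_le_add_sqrt_relEntropy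
    (fun _ => seqLaw_eq_zero (playKernel_eq_zero π v h)) (pullCount_mem_Icc i)

theorem expectation_pullCount_le (hK : 2 ≤ K) (π : Strategy K d) (v : β → Set.Icc (0 : ℝ) 1)
    {μ ν : Fin K → stdSimplex ℝ β} {i : Fin K} (h : ∀ j b, ν j b = 0 → μ j b = 0)
    (hoff : ∀ j ≠ i, ν j = μ j)
    (hcount : expectation (seqLaw (playKernel π v μ) T) (pullCount i) ≤ (T : ℝ) / K)
    (hinfo : 16 * relEntropy (μ i) (ν i) * T ≤ K) :
    expectation (seqLaw (playKernel π v ν) T) (pullCount i) ≤ 3 / 4 * T := by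
  have hK₀ : (0 : ℝ) < K := by exact_mod_cast Nat.zero_lt_of_lt hK
  have hentropy : 0 ≤ relEntropy (μ i) (ν i) :=
    (Finset.sum_nonneg fun b _ => sq_nonneg _).trans
      (sum_sq_sqrt_sub_sqrt_le_relEntropy (h i))
  have hsqrt : √(relEntropy (μ i) (ν i) *
      expectation (seqLaw (playKernel π v μ) T) (pullCount i)) ≤ 1 / 4 := by
    refine Real.sqrt_le_iff.2 ⟨by norm_num, ?_⟩
    calc _ ≤ relEntropy (μ i) (ν i) * (T / K) := mul_le_mul_of_nonneg_left hcount hentropy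
      _ = relEntropy (μ i) (ν i) * T / K := (mul_div_assoc _ _ _).symm
      _ ≤ (1 / 4) ^ 2 := (div_le_iff₀ hK₀).2 (by linarith)
  have hhalf : (T : ℝ) / K ≤ T / 2 :=
    div_le_div_of_nonneg_left T.cast_nonneg two_pos (by exact_mod_cast hK)
  calc _ ≤ _ := expectation_pullCount_le_add_sqrt π v h hoff T
    _ ≤ T / 2 + T * (1 / 4) :=
        add_le_add (hcount.trans hhalf) (mul_le_mul_of_nonneg_left hsqrt T.cast_nonneg)
    _ = 3 / 4 * T := by ring

theorem gap_mul_le_iSup_regret (π : Strategy K d) (v : β → Set.Icc (0 : ℝ) 1)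
    {ν : Fin K → stdSimplex ℝ β} {i : Fin K} {ε : ℝ}
    (hgap : ∀ j ≠ i, expectation (ν j) (fun b => (v b : ℝ)) =
      expectation (ν i) (fun b => (v b : ℝ)) + ε) (T : ℕ) :
    ε * (T - expectation (seqLaw (playKernel π v ν) T) (pullCount i)) ≤
      ⨆ ℓ : LossSeq K, regret π ℓ T := by
  refine Eq.trans_le ?_ (expectation_sum_gap_le_iSup_regret π v ν T i)
  rw [← expectation_const (seqLaw (playKernel π v ν) T) (T : ℝ), ← expectation_sub,
    ← expectation_const_mul]
  congr 1
  funext z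
  calc ε * (T - pullCount i z) = ∑ t, ε * (1 - if (z t).1 = i then 1 else 0) := by
        rw [← Finset.mul_sum, Finset.sum_sub_distrib, pullCount]
        simp
    _ = _ := Finset.sum_congr rfl fun t _ => by
        split_ifs with hi
        · rw [hi, sub_self, sub_self, mul_zero]
        · rw [hgap _ hi]
          ring

/-- The law of a coin which shows `true` with probability `p`. -/
noncomputable def coin (p : Set.Icc (0 : ℝ) 1) : stdSimplex ℝ Bool :=
  ⟨fun b => cond b p (1 - p), fun b => by cases b; exacts [sub_nonneg.2 p.2.2, p.2.1], by simp⟩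

theorem expectation_coin (p : Set.Icc (0 : ℝ) 1) (f : Bool → ℝ) :
    expectation (coin p) f = p * f true + (1 - p) * f false :=
  Fintype.sum_bool _

theorem relEntropy_coin_le {p q : Set.Icc (0 : ℝ) 1} {ε : ℝ} (hp : (p : ℝ) = 1 / 2)
    (hq : (q : ℝ) = 1 / 2 - ε) (hε : |ε| ≤ 1 / 8) : relEntropy (coin p) (coin q) ≤ 3 * ε ^ 2 := by
  obtain ⟨hlo, hhi⟩ := abs_le.1 hε
  have hprod : 0 < (1 - 2 * ε) * (1 + 2 * ε) := by nlinarith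
  have hlog := Real.one_sub_inv_le_log_of_pos hprod
  have hinv : ((1 - 2 * ε) * (1 + 2 * ε))⁻¹ ≤ 1 + 6 * ε ^ 2 := by
    rw [inv_le_iff_one_le_mul₀ hprod]
    nlinarith [mul_nonneg (sq_nonneg ε) (show 0 ≤ 1 / 64 - ε ^ 2 by nlinarith)]
  calc relEntropy (coin p) (coin q)
      = -(1 / 2) * Real.log ((1 - 2 * ε) * (1 + 2 * ε)) := by
        rw [relEntropy, expectation_coin]
        change p * Real.log (p / q) + (1 - p) * Real.log ((1 - p) / (1 - q)) = _
        rw [hp, hq, show (1 / 2 : ℝ) / (1 / 2 - ε) = (1 - 2 * ε)⁻¹ by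
            rw [show (1 / 2 - ε : ℝ) = 1 / 2 * (1 - 2 * ε) by ring, ← div_div,
              div_self (by norm_num), one_div],
          show (1 - 1 / 2 : ℝ) / (1 - (1 / 2 - ε)) = (1 + 2 * ε)⁻¹ by
            rw [show (1 - (1 / 2 - ε) : ℝ) = (1 - 1 / 2) * (1 + 2 * ε) by ring, ← div_div,
              div_self (by norm_num), one_div],
          Real.log_inv, Real.log_inv, Real.log_mul (by linarith) (by linarith)]
        ring
    _ ≤ 3 * ε ^ 2 := by linarith

theorem coin_pos {p : Set.Icc (0 : ℝ) 1} (h : 0 < (p : ℝ)) (h' : (p : ℝ) < 1) (b : Bool) :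
    0 < coin p b := by
  cases b
  exacts [sub_pos.2 h', h]

/-- Against a fair coin per action, some action is played at most `T / K` times; it stays
undetected if its mean loss is then lowered by a small multiple of `√(K / T)`. -/
theorem gap_mul_le_minimaxRegret (hK : 2 ≤ K) (d : ℕ) {ε : ℝ} (hε : 0 ≤ ε) (hle : ε ≤ 1 / 8)
    (hT : 48 * ε ^ 2 * T ≤ K) : ε * T / 4 ≤ minimaxRegret K d T := by
  refine le_minimaxRegret (Nat.zero_lt_of_lt hK) fun π => ?_
  let v : Bool → Set.Icc (0 : ℝ) 1 := fun b => cond b 1 0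
  let fair : Set.Icc (0 : ℝ) 1 := ⟨1 / 2, by norm_num, by norm_num⟩
  let biased : Set.Icc (0 : ℝ) 1 := ⟨1 / 2 - ε, by linarith, by linarith⟩
  let μ : Fin K → stdSimplex ℝ Bool := fun _ => coin fair
  obtain ⟨i, hi⟩ := exists_expectation_pullCount_le (Nat.zero_lt_of_lt hK)
    (seqLaw (playKernel π v μ) T)
  let ν : Fin K → stdSimplex ℝ Bool := Function.update μ i (coin biased)
  have hνi : ν i = coin biased := Function.update_self ..
  have hνj : ∀ j ≠ i, ν j = μ j := fun j hj => Function.update_of_ne hj ..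
  have hν : ∀ j b, ν j b = 0 → μ j b = 0 := fun j b hzero => by
    rcases eq_or_ne j i with rfl | hj
    · rw [hνi] at hzero
      exact absurd hzero (coin_pos (by change 0 < 1 / 2 - ε; linarith)
        (by change 1 / 2 - ε < 1; linarith) b).ne'
    · rwa [hνj j hj] at hzero
  have hmean : ∀ p, expectation (coin p) (fun b => (v b : ℝ)) = p := fun p => by
    simp [expectation_coin, v]
  have hgap := gap_mul_le_iSup_regret π v (ν := ν) (i := i) (ε := ε)
    (fun j hj => by rw [hνj j hj, hνi, hmean, hmean, sub_add_cancel]) T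
  have hentropy := relEntropy_coin_le (p := fair) (q := biased) rfl rfl
    (by rwa [abs_of_nonneg hε])
  have hcount := expectation_pullCount_le hK π v hν hνj hi (by rw [hνi]; nlinarith)
  nlinarith

theorem min_sqrt_arms_le_minimaxRegret (hK : 2 ≤ K) (d T : ℕ) :
    1 / 32 * min (T : ℝ) √(K * T) ≤ minimaxRegret K d T := by
  rcases T.eq_zero_or_pos with rfl | hT
  · simpa using minimaxRegret_nonneg K d 0
  have hT₀ : (0 : ℝ) < T := by exact_mod_cast hT
  set m : ℝ := min (T : ℝ) √(K * T)
  have hm : 0 ≤ m := le_min hT₀.le (Real.sqrt_nonneg _)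
  have hsq : m ^ 2 ≤ K * T :=
    (pow_le_pow_left₀ hm (min_le_right _ _) 2).trans_eq (Real.sq_sqrt (by positivity))
  calc 1 / 32 * m = m / (8 * T) * T / 4 := by field_simp; ring
    _ ≤ minimaxRegret K d T := gap_mul_le_minimaxRegret hK d (by positivity)
        (by
          rw [div_le_div_iff₀ (by positivity) (by norm_num)]
          linarith [min_le_left (T : ℝ) √(K * T)])
        (by
          rw [show 48 * (m / (8 * T)) ^ 2 * T = 3 / 4 * m ^ 2 / T by field_simp; ring,
            div_le_iff₀ hT₀]
          linarith [sq_nonneg m])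

end BanditLowerBound

section SignSum

variable {ι : Type*} [Fintype ι] [DecidableEq ι]

/-- The sum of the weights `c b`, `b ∈ s`, with the signs `σ`. -/
noncomputable def signSum (c : ι → ℝ) (s : Finset ι) (σ : ι → ℤˣ) : ℝ :=
  ∑ b ∈ s, ((σ b : ℤ) : ℝ) * c b

theorem expectation_signSum_insert (c : ι → ℝ) {s : Finset ι} {b : ι} (hb : b ∉ s)
    (f : ℝ → ℝ) :
    expectation stdSimplex.barycenter (fun σ => f (signSum c (insert b s) σ)) =
      expectation stdSimplex.barycenter
        fun σ => 1 / 2 * (f (signSum c s σ + c b) + f (signSum c s σ - c b)) := by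
  have hs : ∀ σ, signSum c (insert b s) σ = ((σ b : ℤ) : ℝ) * c b + signSum c s σ :=
    fun σ => Finset.sum_insert hb
  have hflip : ∀ σ, signSum c s (σ * Pi.mulSingle b (-1)) = signSum c s σ := fun σ =>
    Finset.sum_congr rfl fun a ha => by
      rw [Pi.mul_apply, Pi.mulSingle_eq_of_ne (ne_of_mem_of_not_mem ha hb), mul_one]
  have havg := expectation_barycenter_mul_right
    (fun σ => f (signSum c (insert b s) σ)) (Pi.mulSingle b (-1))
  have hpair : ∀ σ : ι → ℤˣ, f (signSum c (insert b s) σ) +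
      f (signSum c (insert b s) (σ * Pi.mulSingle b (-1))) =
        f (signSum c s σ + c b) + f (signSum c s σ - c b) := fun σ => by
    rw [hs, hs, hflip]
    rcases Int.units_eq_one_or (σ b) with h | h <;> simp [h, add_comm, sub_eq_add_neg]
  have hadd := expectation_add stdSimplex.barycenter (fun σ => f (signSum c (insert b s) σ))
    fun σ => f (signSum c (insert b s) (σ * Pi.mulSingle b (-1)))
  rw [havg] at hadd
  simp only [hpair] at hadd
  rw [expectation_const_mul, hadd]
  ring

theorem expectation_signSum_sq (c : ι → ℝ) (s : Finset ι) :
    expectation stdSimplex.barycenter (fun σ => signSum c s σ ^ 2) = ∑ b ∈ s, c b ^ 2 := by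
  induction s using Finset.induction with
  | empty => simp [signSum]
  | insert b s hb ih =>
    rw [expectation_signSum_insert c hb (· ^ 2), Finset.sum_insert hb, ← ih, add_comm,
      ← expectation_const (stdSimplex.barycenter (X := ι → ℤˣ)) (c b ^ 2), ← expectation_add]
    congr 1
    funext σ
    ring

theorem expectation_signSum_pow_four_le (c : ι → ℝ) (s : Finset ι) :
    expectation stdSimplex.barycenter (fun σ => signSum c s σ ^ 4) ≤
      3 * (∑ b ∈ s, c b ^ 2) ^ 2 := by
  induction s using Finset.induction with
  | empty => simp [signSum]
  | insert b s hb ih =>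
    have hexp : expectation stdSimplex.barycenter (fun σ => signSum c (insert b s) σ ^ 4) =
        expectation stdSimplex.barycenter (fun σ => signSum c s σ ^ 4) +
          6 * c b ^ 2 * ∑ a ∈ s, c a ^ 2 + c b ^ 4 := by
      rw [expectation_signSum_insert c hb (· ^ 4), ← expectation_signSum_sq,
        ← expectation_const_mul,
        ← expectation_const (stdSimplex.barycenter (X := ι → ℤˣ)) (c b ^ 4),
        ← expectation_add, ← expectation_add]
      congr 1
      funext σ
      ring
    rw [hexp, Finset.sum_insert hb]
    nlinarith [sq_nonneg (c b ^ 2)]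

theorem sqrt_le_expectation_abs_signSum (c : ι → ℝ) (s : Finset ι) :
    √((∑ b ∈ s, c b ^ 2) / 3) ≤
      expectation stdSimplex.barycenter fun σ => |signSum c s σ| := by
  have hV : 0 ≤ ∑ b ∈ s, c b ^ 2 := Finset.sum_nonneg fun b _ => sq_nonneg _
  refine Real.sqrt_le_iff.2 ⟨expectation_nonneg _ fun σ => abs_nonneg _, ?_⟩
  have hcube := (cube_expectation_sq_le stdSimplex.barycenter (signSum c s)).trans
    (mul_le_mul_of_nonneg_left (expectation_signSum_pow_four_le c s) (sq_nonneg _))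
  rw [expectation_signSum_sq] at hcube
  rcases hV.eq_or_lt with h | h
  · rw [← h, zero_div]
    exact sq_nonneg _
  · refine le_of_mul_le_mul_left ?_ (mul_pos three_pos (pow_pos h 2))
    linarith

end SignSum

section BlockLoss

variable {K d T : ℕ} {ι : Type*}

/-- Losses in `{0, 1}` that are constant on the blocks, `blk t` being the block of round `t`: in
the block `b`, action `0` suffers `(1 + σ b) / 2` and all other actions `(1 - σ b) / 2`. -/
noncomputable def blockLoss (blk : ℕ → ι) (σ : ι → ℤˣ) : LossSeq K := fun t i =>
  ⟨(1 + (if (i : ℕ) = 0 then 1 else -1) * ((σ (blk t) : ℤ) : ℝ)) / 2, by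
    rcases Int.units_eq_one_or (σ (blk t)) with h | h <;> split_ifs <;> norm_num [h]⟩

theorem blockLoss_apply (blk : ℕ → ι) (σ : ι → ℤˣ) (t : ℕ) (i : Fin K) :
    (blockLoss blk σ t i : ℝ) =
      (1 + (if (i : ℕ) = 0 then 1 else -1) * ((σ (blk t) : ℤ) : ℝ)) / 2 :=
  rfl

variable [DecidableEq ι]

theorem blockLoss_mul_mulSingle_of_ne {blk : ℕ → ι} (σ : ι → ℤˣ) {s : ℕ} {b : ι} (h : blk s ≠ b) :
    (blockLoss blk (σ * Pi.mulSingle b (-1)) s : Fin K → Set.Icc (0 : ℝ) 1) =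
      blockLoss blk σ s := by
  funext i
  apply Subtype.ext
  rw [blockLoss_apply, blockLoss_apply, Pi.mul_apply, Pi.mulSingle_eq_of_ne h, mul_one]

theorem blockLoss_mul_mulSingle_self (blk : ℕ → ι) (σ : ι → ℤˣ) (t : ℕ) (i : Fin K) :
    (blockLoss blk (σ * Pi.mulSingle (blk t) (-1)) t i : ℝ) = 1 - blockLoss blk σ t i := by
  rw [blockLoss_apply, blockLoss_apply, Pi.mul_apply, Pi.mulSingle_eq_same]
  push_cast
  ring

theorem expectation_blockLoss_mul_mulSingle (π : Strategy K d) {blk : ℕ → ι} {t : Fin T}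
    (hblk : ∀ s, s + d < t → blk s ≠ blk t) (σ : ι → ℤˣ) :
    let σ' := σ * Pi.mulSingle (blk t) (-1)
    expectation (seqLaw (actionKernel π (blockLoss blk σ')) T)
        (fun a => (blockLoss blk σ' t (a t) : ℝ)) =
      1 - expectation (seqLaw (actionKernel π (blockLoss blk σ)) T)
        fun a => (blockLoss blk σ t (a t) : ℝ) := by
  intro σ'
  have hkernel : ∀ n ≤ (t : ℕ),
      actionKernel π (blockLoss blk σ') n = actionKernel π (blockLoss blk σ) n := fun n hn =>
    actionKernel_congr π fun s hs => blockLoss_mul_mulSingle_of_ne σ (hblk s (hs.trans_le hn))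
  rw [expectation_seqLaw_past_apply _ t fun _ i => (blockLoss blk σ' t i : ℝ),
    expectation_seqLaw_past_apply _ t fun _ i => (blockLoss blk σ t i : ℝ), hkernel t le_rfl,
    seqLaw_congr fun n hn => hkernel n hn.le]
  simp only [σ', blockLoss_mul_mulSingle_self, expectation_sub, expectation_const]

variable [Fintype ι]

/-- The losses of a block are revealed after its end, so reversing the sign of the current block
changes the loss suffered but not the law of the actions. -/
theorem expectation_expectedLoss_blockLoss (π : Strategy K d) {blk : ℕ → ι}
    (hblk : ∀ t < T, ∀ s, s + d < t → blk s ≠ blk t) :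
    expectation stdSimplex.barycenter (fun σ => expectedLoss π (blockLoss blk σ) T) =
      (T : ℝ) / 2 := by
  have hround : ∀ t : Fin T, expectation stdSimplex.barycenter (fun σ =>
      expectation (seqLaw (actionKernel π (blockLoss blk σ)) T)
        fun a => (blockLoss blk σ t (a t) : ℝ)) = 1 / 2 := fun t => by
    have hflip := expectation_barycenter_mul_right (fun σ : ι → ℤˣ =>
      expectation (seqLaw (actionKernel π (blockLoss blk σ)) T)
        fun a => (blockLoss blk σ t (a t) : ℝ)) (Pi.mulSingle (blk t) (-1))
    simp only [expectation_blockLoss_mul_mulSingle π (hblk t t.isLt), expectation_sub,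
      expectation_const] at hflip
    linarith
  simp only [expectedLoss_eq_expectation, expectation_sum, hround]
  simp [div_eq_mul_inv]

/-- The number of rounds of block `b` among the first `T` rounds. -/
def blockSize (blk : ℕ → ι) (T : ℕ) (b : ι) : ℝ :=
  ((Finset.range T).filter fun t => blk t = b).card

theorem sum_blockSize (blk : ℕ → ι) (T : ℕ) : ∑ b, blockSize blk T b = T := by
  unfold blockSize
  rw [← Nat.cast_sum, ← Finset.card_eq_sum_card_fiberwise fun t _ => Finset.mem_univ (blk t),
    Finset.card_range]

theorem sum_sign_blk (blk : ℕ → ι) (σ : ι → ℤˣ) (T : ℕ) :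
    ∑ t ∈ Finset.range T, ((σ (blk t) : ℤ) : ℝ) = signSum (blockSize blk T) Finset.univ σ := by
  rw [signSum, ← Finset.sum_fiberwise' _ blk fun b => ((σ b : ℤ) : ℝ)]
  simp only [blockSize, Finset.sum_const, nsmul_eq_mul, mul_comm]

theorem iInf_sum_blockLoss_le (hK : 2 ≤ K) (blk : ℕ → ι) (σ : ι → ℤˣ) (T : ℕ) :
    ⨅ i : Fin K, ∑ t ∈ Finset.range T, (blockLoss blk σ t i : ℝ) ≤
      T / 2 - 1 / 2 * |signSum (blockSize blk T) Finset.univ σ| := by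
  have hfirst := iInf_sum_loss_le (blockLoss blk σ) T (⟨0, by omega⟩ : Fin K)
  have hsecond := iInf_sum_loss_le (blockLoss blk σ) T (⟨1, by omega⟩ : Fin K)
  simp only [blockLoss_apply, if_true, one_ne_zero, if_false, ← Finset.sum_div,
    Finset.sum_add_distrib, ← Finset.mul_sum, sum_sign_blk, Finset.sum_const, Finset.card_range,
    nsmul_eq_mul] at hfirst hsecond ⊢
  rcases abs_cases (signSum (blockSize blk T) Finset.univ σ) with ⟨h, -⟩ | ⟨h, -⟩ <;>
    rw [h] <;> linarith

end BlockLoss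

section DelayLowerBound

variable {K d T : ℕ}

theorem sqrt_le_minimaxRegret_of_blocks {ι : Type*} [Fintype ι] (hK : 2 ≤ K) {blk : ℕ → ι}
    (hblk : ∀ t < T, ∀ s, s + d < t → blk s ≠ blk t) :
    √((T : ℝ) ^ 2 / (12 * Fintype.card ι)) ≤ minimaxRegret K d T := by
  classical
  refine le_minimaxRegret (Nat.zero_lt_of_lt hK) fun π => ?_
  have hvar : (T : ℝ) ^ 2 / Fintype.card ι ≤ ∑ b, blockSize blk T b ^ 2 := by
    refine div_le_of_le_mul₀ (Nat.cast_nonneg _) (Finset.sum_nonneg fun b _ => sq_nonneg _) ?_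
    rw [← sum_blockSize blk T, mul_comm]
    exact sq_sum_le_card_mul_sum_sq
  calc √((T : ℝ) ^ 2 / (12 * Fintype.card ι))
      = 1 / 2 * √((T : ℝ) ^ 2 / Fintype.card ι / 3) := by
        rw [show (T : ℝ) ^ 2 / (12 * Fintype.card ι) =
            (1 / 2) ^ 2 * ((T : ℝ) ^ 2 / Fintype.card ι / 3) by ring,
          Real.sqrt_mul (sq_nonneg _), Real.sqrt_sq (by norm_num)]
    _ ≤ 1 / 2 * expectation stdSimplex.barycenter fun σ =>
          |signSum (blockSize blk T) Finset.univ σ| := by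
        gcongr
        exact (Real.sqrt_le_sqrt (by gcongr)).trans (sqrt_le_expectation_abs_signSum _ _)
    _ = expectation stdSimplex.barycenter fun σ => expectedLoss π (blockLoss blk σ) T -
          (T / 2 - 1 / 2 * |signSum (blockSize blk T) Finset.univ σ|) := by
        rw [expectation_sub, expectation_sub, expectation_expectedLoss_blockLoss π hblk,
          expectation_const, expectation_const_mul]
        ring
    _ ≤ expectation stdSimplex.barycenter fun σ => regret π (blockLoss blk σ) T :=
        expectation_mono _ fun σ => sub_le_sub_left (iInf_sum_blockLoss_le hK blk σ T) _
    _ ≤ ⨆ ℓ : LossSeq K, regret π ℓ T := expectation_regret_le_iSup _ π _ T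

theorem sqrt_length_mul_le_minimaxRegret (hK : 2 ≤ K) {L : ℕ} (hL : 0 < L) (hLd : L ≤ d + 1)
    (hLT : L ≤ T) : 1 / 5 * √((L : ℝ) * T) ≤ minimaxRegret K d T := by
  let blk : ℕ → Fin (T / L + 1) := fun t => Fin.ofNat _ (t / L)
  have hblk : ∀ t < T, ∀ s, s + d < t → blk s ≠ blk t := fun t ht s hs heq => by
    have hval : ∀ r < T, (blk r : ℕ) = r / L := fun r hr =>
      Nat.mod_eq_of_lt (Nat.lt_succ_of_le (Nat.div_le_div_right hr.le))
    have hdiv : s / L = t / L := by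
      rw [← hval s (by omega), ← hval t ht, heq]
    have hmod := Nat.mod_lt t hL
    have hs := Nat.div_add_mod s L
    have ht := Nat.div_add_mod t L
    rw [hdiv] at hs
    omega
  refine le_trans ?_ (sqrt_le_minimaxRegret_of_blocks hK hblk)
  have hcard : (Fintype.card (Fin (T / L + 1)) : ℝ) * L ≤ 2 * T := by
    rw [Fintype.card_fin]
    exact_mod_cast show (T / L + 1) * L ≤ 2 * T by linarith [Nat.div_mul_le_self T L]
  rw [show (1 : ℝ) / 5 = √(1 / 25) by
      rw [show (1 : ℝ) / 25 = (1 / 5) ^ 2 by norm_num, Real.sqrt_sq (by norm_num)],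
    ← Real.sqrt_mul (by norm_num)]
  refine Real.sqrt_le_sqrt ((le_div_iff₀ (by positivity)).2 ?_)
  nlinarith [mul_le_mul_of_nonneg_right hcard (T.cast_nonneg (α := ℝ))]

theorem min_sqrt_delay_le_minimaxRegret (hK : 2 ≤ K) (d T : ℕ) :
    1 / 5 * min (T : ℝ) √((d + 1) * T) ≤ minimaxRegret K d T := by
  rcases T.eq_zero_or_pos with rfl | hT
  · simpa using minimaxRegret_nonneg K d 0
  rcases le_total (d + 1) T with h | h
  · have := sqrt_length_mul_le_minimaxRegret (d := d) hK d.succ_pos le_rfl h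
    push_cast at this
    linarith [min_le_right (T : ℝ) √((d + 1) * T)]
  · have := sqrt_length_mul_le_minimaxRegret hK hT h le_rfl
    rw [Real.sqrt_mul_self T.cast_nonneg] at this
    linarith [min_le_left (T : ℝ) √((d + 1) * T)]

end DelayLowerBound

theorem min_sqrt_add_le {x a b : ℝ} (hx : 0 ≤ x) (ha : 0 ≤ a) (hb : 0 ≤ b) :
    min x √(a + b) ≤ min x √a + min x √b := by
  have hadd : √(a + b) ≤ √a + √b := Real.sqrt_le_iff.2 ⟨by positivity, by
    nlinarith [Real.sq_sqrt ha, Real.sq_sqrt hb,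
      mul_nonneg (Real.sqrt_nonneg a) (Real.sqrt_nonneg b)]⟩
  rcases le_total x √a with h | h
  · rw [min_eq_left h]
    exact (min_le_left _ _).trans (le_add_of_nonneg_right (le_min hx (Real.sqrt_nonneg b)))
  rcases le_total x √b with h' | h'
  · rw [min_eq_left h']
    exact (min_le_left _ _).trans (le_add_of_nonneg_left (le_min hx (Real.sqrt_nonneg a)))
  · rw [min_eq_right h, min_eq_right h']
    exact (min_le_right _ _).trans hadd

theorem min_sqrt_le_minimaxRegret {K : ℕ} (hK : 2 ≤ K) (d T : ℕ) :
    1 / 37 * min (T : ℝ) √((K + d) * T) ≤ minimaxRegret K d T := by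
  have hsplit : min (T : ℝ) √((K + d) * T) ≤
      min (T : ℝ) √(K * T) + min (T : ℝ) √((d + 1) * T) :=
    (min_le_min_left _ (Real.sqrt_le_sqrt (by nlinarith [T.cast_nonneg (α := ℝ)]))).trans
      (min_sqrt_add_le (b := (d + 1) * T) (by positivity) (by positivity) (by positivity))
  linarith [min_sqrt_arms_le_minimaxRegret hK d T, min_sqrt_delay_le_minimaxRegret hK d T]

end DelayedBandit

theorem corollaryc :
    ∃ c C : ℝ, 0 < c ∧ 0 < C ∧ ∀ (K d T : ℕ) (hK : 2 ≤ K),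
      c * min (T : ℝ) (√(((K : ℝ) + d) * T)) ≤ DelayedBandit.minimaxRegret K d T ∧
      DelayedBandit.minimaxRegret K d T ≤
        C * min (T : ℝ) (√(((K : ℝ) + d) * T * Real.log K)) ∧
      ∃ η : ℝ, 0 < η ∧ ∀ ℓ : DelayedBandit.LossSeq K,
        DelayedBandit.regret (DelayedBandit.exp3 (Nat.zero_lt_of_lt hK) d η) ℓ T ≤
          C * ((d : ℝ) + √(((K : ℝ) + d) * T * Real.log K)) := by
  refine ⟨1 / 37, 5, by norm_num, by norm_num, fun K d T hK =>
    ⟨DelayedBandit.min_sqrt_le_minimaxRegret hK d T,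
      DelayedBandit.minimaxRegret_le_min_sqrt hK d T, ?_⟩⟩
  obtain ⟨η, hη, hregret⟩ := DelayedBandit.exists_regret_exp3_le hK d T
  exact ⟨η, hη, fun ℓ => (hregret ℓ).trans
    (mul_le_mul_of_nonneg_left (le_add_of_nonneg_left d.cast_nonneg) (by norm_num))⟩
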